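/- Let $p$ be a prime, let $G$ be a finite $p$-solvable group (it has a series of normal subgroups from $1$ to $G$ all of whose factors are $p$-groups or $p'$-groups), and let $P$ be a Sylow $p$-subgroup of $G$. Let $F$ be an algebraically closed field of characteristic $p$, and form Brauer characters with respect to a fixed embedding of the roots of unity of $F$ into $\mathbb{C}^\times$. Let $\operatorname{IBr}_p(X)$ be the set of irreducible $p$-Brauer characters of a finite group $X$, that is, the Brauer characters of the irreducible $FX$-modules. Let $\varphi\in\operatorname{IBr}_p(G)$ be afforded by the irreducible $FG$-module $V$. Put $\varphi^{\mathrm{Fix}(P)}(1)=\dim_F\{v\in V : v \text{ is fixed by every } x\in P\}$ and $c_\varphi=\Phi_\varphi(1)/|G|_p$, where $\Phi_\varphi(1)$ is the dimension of the projective indecomposable $FG$-module with head $V$, and $|G|_p$ is the largest power of $p$ dividing $|G|$. For a positive integer $n$, let $n_{p'}$ be the largest divisor of $n$ prime to $p$. Let $(J,\gamma)$ be a Huppert pair for $\varphi$: $J\le G$ is a subgroup, and $\gamma\in\operatorname{IBr}_p(J)$ satisfies $p\nmid\gamma(1)$ and $\gamma^G=\varphi$, where $\gamma^G$ is the induced Brauer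 character. Let $\operatorname{Ker}\gamma$ be the kernel of the representation of $J$ affording $\gamma$, and write $P^x=x^{-1}Px$. Then the following are equivalent: a) $\varphi^{\mathrm{Fix}(P)}(1)=c_\varphi=\varphi(1)_{p'}$; b) $p\nmid |J:\operatorname{Ker}\gamma|$, and $P^x\cap J$ is a Sylow $p$-subgroup of $J$ for every $x\in G$. -/

import Mathlib

open scoped MonoidAlgebra

noncomputable section

universe u v

/-- A Brauer lift for the field `F`: a multiplicative map `F → ℂ` which is injective on the roots of
unity of `F`, i.e. an embedding of the group of roots of unity of `F` into `ℂˣ`. If `F` is an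
algebraically closed field of characteristic `p`, the roots of unity of `F` have order prime to `p`,
and the map identifies them with the complex roots of unity of order prime to `p`. The values at
elements of infinite multiplicative order are irrelevant. -/
structure BrauerLift (F : Type u) [Field F] where
  toHom : F →*₀ ℂ
  eq_one_of_toHom_eq_one : ∀ ζ : F, IsOfFinOrder ζ → toHom ζ = 1 → ζ = 1

/-- The set of `p`-regular elements of `G` (elements of order prime to `p`). -/
def PRegular (p : ℕ) (G : Type v) [Group G] : Type v :=
  {g : G // (orderOf g).Coprime p}

/-- A finite group is `p`-solvable if it has a series of normal subgroups from `1` to `G`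
each of whose factors is a `p`-group or a `p'`-group. -/
def IsPSolvable (p : ℕ) (G : Type v) [Group G] : Prop :=
  ∃ (n : ℕ) (N : ℕ → Subgroup G), N 0 = ⊥ ∧ N n = ⊤ ∧ (∀ i, (N i).Normal) ∧
    ∀ i < n, N i ≤ N (i + 1) ∧
      ((∃ k : ℕ, (N i).relIndex (N (i + 1)) = p ^ k) ∨
        ((N i).relIndex (N (i + 1))).Coprime p)

/-- The Brauer character of a finite-dimensional representation `ρ` over `F`: the value at a
`p`-regular element `g` is the sum of the lifts of the eigenvalues of `ρ g`,
with multiplicities. -/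
def brauerCharacter (p : ℕ) {F : Type u} [Field F] (L : BrauerLift F) {G : Type v} [Group G]
    {n : ℕ} (ρ : Representation F G (Fin n → F)) : PRegular p G → ℂ :=
  fun g => ((ρ g.1).charpoly.roots.map L.toHom).sum

/-- `IBr_p(G)`: the irreducible `p`-Brauer characters of `G`, i.e. the functions on the `p`-regular
elements which are the Brauer character of an irreducible `F`-representation. -/
@[ext]
structure IBr (p : ℕ) {F : Type u} [Field F] (L : BrauerLift F) (G : Type v) [Group G] where
  toFun : PRegular p G → ℂ
  exists_rep : ∃ (n : ℕ) (ρ : Representation F G (Fin n → F)),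
    ρ.IsIrreducible ∧ brauerCharacter p L ρ = toFun

namespace IBr

variable {p : ℕ} {F : Type u} [Field F] {L : BrauerLift F} {G : Type v} [Group G]

/-- The degree of `φ`, as a natural number. -/
def degree (φ : IBr p L G) : ℕ := φ.exists_rep.choose

/-- The irreducible `F`-representation affording `φ`. -/
def rep (φ : IBr p L G) : Representation F G (Fin φ.degree → F) :=
  φ.exists_rep.choose_spec.choose

theorem rep_irreducible (φ : IBr p L G) : φ.rep.IsIrreducible :=
  φ.exists_rep.choose_spec.choose_spec.1

theorem brauerCharacter_rep (φ : IBr p L G) : brauerCharacter p L φ.rep = φ.toFun :=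
  φ.exists_rep.choose_spec.choose_spec.2

/-- `degree φ` is indeed the value `φ(1)`. -/
theorem degree_eq (φ : IBr p L G) : (φ.degree : ℂ) = φ.toFun ⟨1, by simp⟩ := by
  rw [← brauerCharacter_rep]
  unfold brauerCharacter
  rw [map_one, LinearMap.charpoly_one, Module.finrank_fin_fun]
  rw [show (Polynomial.X - 1 : Polynomial F) = Polynomial.X - Polynomial.C 1 by simp,
    Polynomial.roots_pow, Polynomial.roots_X_sub_C]
  simp [Multiset.map_nsmul, Multiset.sum_nsmul]

/-- `Ker φ`, the kernel of the representation affording `φ`. -/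
def ker (φ : IBr p L G) : Subgroup G := MonoidHom.ker φ.rep

/-- `φ^{Fix(P)}(1)`: the dimension of the space of `P`-fixed points of the module affording `φ`. -/
def fixDegree (φ : IBr p L G) (P : Subgroup G) : ℕ :=
  Module.finrank F (Representation.invariants (φ.rep.comp P.subtype))

end IBr

/-- A nonzero module is indecomposable if it is not the direct sum of two proper submodules. -/
def IsIndecomposableModule (R : Type u) [Ring R] (M : Type v) [AddCommGroup M] [Module R M] :
    Prop :=
  Nontrivial M ∧ ∀ A B : Submodule R M, IsCompl A B → A = ⊤ ∨ B = ⊤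

/-- `Q` is a `φ`-PIM: a projective indecomposable `FG`-module whose head `Q / rad Q` is the
module affording `φ`. -/
structure IsPIM {p : ℕ} {F : Type u} [Field F] {L : BrauerLift F} {G : Type v} [Group G]
    (φ : IBr p L G) (Q : Type*) [AddCommGroup Q] [Module F[G] Q] : Prop where
  projective : Module.Projective F[G] Q
  indecomposable : IsIndecomposableModule F[G] Q
  head : Nonempty ((Q ⧸ Module.jacobson F[G] Q) ≃ₗ[F[G]] φ.rep.asModule)

/-- Every simple module over an artinian ring is the head of an indecomposable projective
left ideal. -/
theorem exists_pim_of_simple {R : Type*} [Ring R] [IsArtinianRing R] (S : Type*) [AddCommGroup S]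
    [Module R S] [IsSimpleModule R S] : ∃ Q : Submodule R R, Module.Projective R Q ∧
      IsIndecomposableModule R Q ∧ Nonempty ((Q ⧸ Module.jacobson R Q) ≃ₗ[R] S) := by
  let T : Set (Submodule R R) := {Q | Module.Projective R Q ∧ ∃ f : Q →ₗ[R] S, f ≠ 0}
  have hT : T.Nonempty := by
    refine ⟨⊤, Module.Projective.of_equiv Submodule.topEquiv.symm, ?_⟩
    have := IsSimpleModule.nontrivial R S
    obtain ⟨s, hs⟩ := exists_ne (0 : S)
    refine ⟨(LinearMap.toSpanSingleton R S s) ∘ₗ Submodule.topEquiv.toLinearMap, fun h => hs ?_⟩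
    simpa using LinearMap.congr_fun h ⟨1, trivial⟩
  obtain ⟨Q, ⟨hQp, f, hf⟩, hmin⟩ := wellFounded_lt.has_min T hT
  have hsurj := LinearMap.surjective_of_ne_zero hf
  -- every proper submodule of `Q` is contained in the kernel of `f`
  have key : ∀ N : Submodule R Q, N ≠ ⊤ → N ≤ LinearMap.ker f := by
    intro N hN
    by_contra hle
    have hfN : f ∘ₗ N.subtype ≠ 0 := by
      intro h
      exact hle fun x hx => LinearMap.congr_fun h ⟨x, hx⟩
    obtain ⟨h, hh⟩ := Module.projective_lifting_property (f ∘ₗ N.subtype) f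
      (LinearMap.surjective_of_ne_zero hfN)
    let e : Module.End R Q := N.subtype ∘ₗ h
    have he : f ∘ₗ e = f := hh
    have hpow : ∀ n, f ∘ₗ (e ^ n) = f := by
      intro n
      induction n with
      | zero => rfl
      | succ k ih => rw [pow_succ', Module.End.mul_eq_comp, ← LinearMap.comp_assoc, he, ih]
    obtain ⟨n, hn, hcompl⟩ := ((Filter.eventually_ge_atTop 1).and
      (LinearMap.eventually_isCompl_ker_pow_range_pow e)).exists
    have hrange : LinearMap.range (e ^ n) ≤ N := by
      obtain ⟨m, rfl⟩ := Nat.exists_eq_succ_of_ne_zero (by omega : n ≠ 0)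
      rw [Nat.succ_eq_add_one, pow_succ', Module.End.mul_eq_comp]
      exact (LinearMap.range_comp_le_range _ _).trans
        (by rintro _ ⟨x, rfl⟩; exact (h x).2)
    obtain ⟨I, hI⟩ : ∃ I, I = LinearMap.range (e ^ n) := ⟨_, rfl⟩
    rw [← hI] at hcompl hrange
    have hIproj : Module.Projective R I :=
      Module.Projective.of_split I.subtype (I.projectionOnto _ hcompl.symm)
        (LinearMap.ext fun x => Submodule.projectionOnto_apply_left hcompl.symm x)
    let J : Submodule R R := I.map Q.subtype
    let eJ : I ≃ₗ[R] J := Submodule.equivMapOfInjective Q.subtype Q.injective_subtype I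
    have hJT : J ∈ T := by
      refine ⟨Module.Projective.of_equiv eJ, (f ∘ₗ I.subtype) ∘ₗ eJ.symm.toLinearMap, fun h0 => hf ?_⟩
      rw [← hpow n]
      ext x
      have := LinearMap.congr_fun h0 (eJ ⟨(e ^ n) x, hI ▸ ⟨x, rfl⟩⟩)
      simpa using this
    refine hmin J hJT (lt_of_le_of_ne (Submodule.map_subtype_le _ _) fun hJQ => hN ?_)
    rw [eq_top_iff]
    intro x _
    have hx : (x : R) ∈ J := hJQ.ge x.2
    obtain ⟨y, hy, hyx⟩ := hx
    rw [← Subtype.ext hyx]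
    exact hrange hy
  have hker : LinearMap.ker f ≠ ⊤ := fun h => hf (LinearMap.ker_eq_top.1 h)
  have hjac : Module.jacobson R Q = LinearMap.ker f := by
    refine le_antisymm (sInf_le ⟨hker, fun N hN => ?_⟩) (le_sInf fun N hN => ?_)
    · by_contra hN'
      exact absurd (key N hN') (not_le_of_gt hN)
    · rcases hN.le_iff.1 (le_sup_left : N ≤ N ⊔ LinearMap.ker f) with h | h
      · have h1 := key N hN.1
        rw [sup_eq_right.2 h1] at h
        exact absurd h hker
      · exact sup_eq_left.1 h
  refine ⟨Q, hQp, ⟨?_, ?_⟩, ⟨?_⟩⟩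
  · by_contra h
    rw [not_nontrivial_iff_subsingleton] at h
    exact hf (Subsingleton.elim _ _)
  · intro A B hAB
    by_contra! h
    exact hker (top_le_iff.1 (hAB.sup_eq_top ▸ sup_le (key A h.1) (key B h.2)))
  · rw [hjac]
    exact f.quotKerEquivOfSurjective hsurj

namespace IBr

variable {p : ℕ} {F : Type u} [Field F] {L : BrauerLift F} {G : Type v} [Group G] [Finite G]

theorem exists_pim (φ : IBr p L G) : ∃ Q : Submodule F[G] F[G], IsPIM φ Q := by
  have := φ.rep_irreducible
  have : IsArtinianRing F[G] := isArtinian_of_tower F inferInstance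
  obtain ⟨Q, h1, h2, h3⟩ := exists_pim_of_simple (R := F[G]) φ.rep.asModule
  exact ⟨Q, h1, h2, h3⟩

/-- The `φ`-PIM, realized as a left ideal of `FG` (it is unique up to isomorphism). -/
def pim (φ : IBr p L G) : Submodule F[G] F[G] := φ.exists_pim.choose

theorem isPIM_pim (φ : IBr p L G) : IsPIM φ φ.pim := φ.exists_pim.choose_spec

/-- `c_φ = Φ_φ(1) / |G|_p`, where `Φ_φ(1)` is the dimension of the `φ`-PIM. -/
def c (φ : IBr p L G) : ℚ :=
  (Module.finrank F φ.pim : ℚ) / (ordProj[p] (Nat.card G) : ℕ)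

end IBr

open Classical in
/-- The Brauer character of `G` induced from the function `γ` on the `p`-regular elements
of the subgroup `J`:
`γ^G(g) = |J|⁻¹ ∑ γ(x g x⁻¹)`, the sum over all `x ∈ G` with `x g x⁻¹ ∈ J`. -/
def inducedBrauer {p : ℕ} {G : Type v} [Group G] (J : Subgroup G) (γ : PRegular p J → ℂ) :
    PRegular p G → ℂ :=
  fun g => (Nat.card J : ℂ)⁻¹ * ∑ᶠ x : G,
    if h : x * g.1 * x⁻¹ ∈ J then
      γ ⟨⟨x * g.1 * x⁻¹, h⟩, by
        rw [Subgroup.orderOf_mk, ← MulAut.conj_apply, MulEquiv.orderOf_eq]; exact g.2⟩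
    else 0

/-- `(J, γ)` is a Huppert pair of `φ`: `γ` has degree prime to `p` and `γ^G = φ`. -/
structure IsHuppertPair {p : ℕ} {F : Type u} [Field F] {L : BrauerLift F} {G : Type v} [Group G]
    (φ : IBr p L G) (J : Subgroup G) (γ : IBr p L J) : Prop where
  not_dvd_degree : ¬ p ∣ γ.degree
  induced_eq : inducedBrauer J γ.toFun = φ.toFun

/-- The conjugate subgroup `P^x = x⁻¹ P x`. -/
def conjSubgroup {G : Type v} [Group G] (P : Subgroup G) (x : G) : Subgroup G :=
  P.map (MulAut.conj x⁻¹).toMonoidHom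

end

/-! Let `W` afford `γ`. Equality of Brauer characters gives `V ≅ Ind_J^G W`
(`IsHuppertPair.exists_equiv`). Traces in characteristic `p` do not determine a module in general,
but together with the dimension they do when one of the two modules is simple. Since `p ∤ γ(1)`,
also `φ(1)_{p'} = |G:J|_{p'} γ(1)`.

Mackey's formula writes `V^P` as a sum, over the `P`-orbits on `G/J`, of the fixed spaces of `P^x ∩
J` on `W`. The orbit of `xJ` has length `|P| / |P^x ∩ J| ≥ |G:J|_p`, so there are at most
`|G:J|_{p'}` orbits and `dim V^P ≤ φ(1)_{p'}`. Equality holds exactly when every `P^x ∩ J` is Sylow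
in `J` and acts trivially on `W`, which is condition b), as `Ker γ` is normal in `J`.

It remains to deduce `Φ_φ(1) = |G|_p φ(1)_{p'}` from b). For the upper bound, `p`-solvability gives
a Hall `p'`-subgroup `H` of `J`. The nonzero `H`-map `W → V` lifts to the PIM, which is therefore a
quotient of `Ind_H^G W`, of dimension `|G:J| |J|_p γ(1)` (`IsPIM.finrank_le_index_mul`). For the
lower bound, `V` has a trivial `P`-quotient of dimension `|G:J|_{p'} γ(1)`, and a projective module
over it has dimension at least `|P|` times as large (`Module.Projective.card_mul_finrank_le`). -/

section Reduction

/-! ### From complex Brauer character values to traces in `F`. -/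

open Polynomial in
/-- Reduction modulo a prime above `p`: a coincidence between the lifts of two sums of roots of
unity of order prime to `p` forces a coincidence between the sums themselves. -/
theorem BrauerLift.sum_eq_of_sum_map_eq {F : Type*} [Field F] [IsAlgClosed F] (L : BrauerLift F)
    {n : ℕ} (hn : (n : F) ≠ 0) {A B : Multiset F} (hA : ∀ a ∈ A, a ^ n = 1)
    (hB : ∀ b ∈ B, b ^ n = 1) (h : (A.map L.toHom).sum = (B.map L.toHom).sum) :
    A.sum = B.sum := by
  have : NeZero (n : F) := ⟨hn⟩
  have hn0 : 0 < n := Nat.pos_of_ne_zero fun h => hn (by simp [h])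
  obtain ⟨ζ, hζ⟩ := HasEnoughRootsOfUnity.exists_primitiveRoot F n
  have hω : IsPrimitiveRoot (L.toHom ζ) n := by
    refine ⟨by rw [← map_pow, hζ.pow_eq_one, map_one], fun k hk => hζ.dvd_of_pow_eq_one k ?_⟩
    refine L.eq_one_of_toHom_eq_one _ ?_ (by rwa [map_pow])
    exact isOfFinOrder_iff_pow_eq_one.2 ⟨n, hn0, by
      rw [← pow_mul, mul_comm, pow_mul, hζ.pow_eq_one, one_pow]⟩
  -- A single integer polynomial computes both sums, at `ζ` and at its lift.
  have key : ∀ C : Multiset F, (∀ c ∈ C, c ^ n = 1) → ∃ q : ℤ[X],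
      aeval ζ q = C.sum ∧ aeval (L.toHom ζ) q = (C.map L.toHom).sum := by
    intro C
    induction C using Multiset.induction_on with
    | empty => exact fun _ => ⟨0, by simp, by simp⟩
    | cons c C ih =>
      intro hC
      obtain ⟨q, h1, h2⟩ := ih fun c hc => hC c (Multiset.mem_cons_of_mem hc)
      have : NeZero n := ⟨hn0.ne'⟩
      obtain ⟨i, -, rfl⟩ := hζ.eq_pow_of_pow_eq_one (hC c (Multiset.mem_cons_self c C))
      exact ⟨X ^ i + q, by simp [h1], by simp [h2]⟩
  obtain ⟨q, hq, hq'⟩ := key A hA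
  obtain ⟨r, hr, hr'⟩ := key B hB
  -- The difference vanishes at a primitive complex root, so it is a multiple of the cyclotomic
  -- polynomial over `ℤ`, which also kills `ζ` in `F`.
  have hdvd : cyclotomic n ℤ ∣ q - r := by
    rw [cyclotomic_eq_minpoly hω hn0]
    exact minpoly.isIntegrallyClosed_dvd (hω.isIntegral hn0)
      (by rw [map_sub, hq', hr', h, sub_self])
  obtain ⟨s, hs⟩ := hdvd
  have h0 : aeval ζ (cyclotomic n ℤ) = 0 := by
    rw [aeval_def, eval₂_eq_eval_map, map_cyclotomic]
    exact hζ.isRoot_cyclotomic hn0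
  have := congrArg (aeval ζ) hs
  rwa [map_mul, h0, zero_mul, map_sub, hq, hr, sub_eq_zero] at this

variable {F : Type*} [Field F] {V : Type*} [AddCommGroup V] [Module F V]

theorem Representation.pow_eq_one_of_mem_roots_charpoly [Module.Finite F V] {G : Type*} [Group G]
    (ρ : Representation F G V) {g : G} {n : ℕ} (hg : g ^ n = 1) {a : F}
    (ha : a ∈ (ρ g).charpoly.roots) : a ^ n = 1 := by
  have hroot : Module.End.HasEigenvalue (ρ g) a :=
    (Module.End.hasEigenvalue_iff_isRoot_charpoly _ _).2 (Polynomial.isRoot_of_mem_roots ha)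
  obtain ⟨v, hv⟩ := hroot.exists_hasEigenvector
  have h1 := hv.pow_apply n
  rw [← map_pow, hg, map_one, Module.End.one_apply] at h1
  by_contra hne
  refine hv.2 ((smul_eq_zero.1 (?_ : (1 - a ^ n) • v = 0)).resolve_left
    (sub_ne_zero.2 (Ne.symm hne)))
  rw [sub_smul, ← h1, one_smul, sub_self]

/-- The `p`-regular part of a group element is one of its powers. -/
theorem exists_pow_coprime_orderOf {p : ℕ} [Fact p.Prime] {G : Type*} [Group G] [Finite G] (g : G) :
    ∃ k a : ℕ, (orderOf (g ^ k)).Coprime p ∧ (g ^ k) ^ p ^ a = g ^ p ^ a := by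
  have hp : p.Prime := Fact.out
  have hg0 : orderOf g ≠ 0 := (orderOf_pos g).ne'
  have hcop : (ordProj[p] (orderOf g)).Coprime (ordCompl[p] (orderOf g)) :=
    (Nat.coprime_ordCompl hp hg0).pow_left _
  -- Take `k` to be `0` modulo the `p`-part of the order and `1` modulo the `p'`-part.
  obtain ⟨k, hk0, hk1⟩ := Nat.chineseRemainder hcop 0 1
  have hmul : ordProj[p] (orderOf g) * ordCompl[p] (orderOf g) = orderOf g :=
    Nat.ordProj_mul_ordCompl_eq_self _ _
  refine ⟨k, (orderOf g).factorization p, ?_, ?_⟩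
  · refine Nat.Coprime.coprime_dvd_left (orderOf_dvd_of_pow_eq_one
      (n := ordCompl[p] (orderOf g)) ?_) (Nat.coprime_ordCompl hp hg0).symm
    rw [← pow_mul, ← orderOf_dvd_iff_pow_eq_one]
    nth_rewrite 1 [← hmul]
    exact mul_dvd_mul_right (Nat.modEq_zero_iff_dvd.1 hk0) _
  · rw [← pow_mul, pow_eq_pow_iff_modEq]
    nth_rewrite 1 [← hmul]
    have := hk1.mul_left' (ordProj[p] (orderOf g))
    rwa [mul_one, mul_comm _ k] at this

/-- In characteristic `p`, the trace only depends on the `p`-regular part. -/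
theorem Representation.trace_eq_of_pow_char_pow_eq (p : ℕ) [Fact p.Prime] [CharP F p] {G : Type*}
    [Group G] (ρ : Representation F G V) {g h : G} (hgh : Commute g h) {a : ℕ}
    (hpow : h ^ p ^ a = g ^ p ^ a) :
    LinearMap.trace F V (ρ g) = LinearMap.trace F V (ρ h) := by
  -- Frobenius for commuting operators: the `p ^ a`-th power of the difference is the difference of
  -- the `p ^ a`-th powers.
  have hnil : IsNilpotent (ρ g - ρ h) := by
    rcases subsingleton_or_nontrivial V with hV | hV
    · exact ⟨1, LinearMap.ext fun v => Subsingleton.elim _ _⟩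
    have : CharP (Module.End F V) p := charP_of_injective_algebraMap
      (FaithfulSMul.algebraMap_injective F (Module.End F V)) p
    refine ⟨p ^ a, ?_⟩
    rw [sub_pow_char_pow_of_commute, ← map_pow, ← map_pow, hpow, sub_self]
    exact hgh.map ρ
  have := LinearMap.isNilpotent_trace_of_isNilpotent hnil
  rwa [isNilpotent_iff_eq_zero, map_sub, sub_eq_zero] at this

end Reduction

/-! ### Recognizing a simple module by its dimension and traces. -/

section TraceForm

variable {F A V : Type*} [Field F] [Ring A] [Algebra F A] [AddCommGroup V] [Module A V]
  [IsSimpleModule A V]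

/-- A simple module annihilated by the annihilator of another simple module, finite-dimensional
over a base field, is isomorphic to it. -/
theorem IsSimpleModule.nonempty_equiv_of_annihilator_le {N : Type*} [AddCommGroup N] [Module F N]
    [Module A N] [IsScalarTower F A N] [Module.Finite F N] [IsSimpleModule A N]
    (h : Module.annihilator A N ≤ Module.annihilator A V) : Nonempty (N ≃ₗ[A] V) := by
  have := IsSimpleModule.nontrivial A V
  obtain ⟨v, hv⟩ := exists_ne (0 : V)
  let b := Module.finBasis F N
  let f : A →ₗ[A] (Fin (Module.finrank F N) → N) :=
    LinearMap.pi fun i => LinearMap.toSpanSingleton A N (b i)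
  have hker : LinearMap.ker f ≤ LinearMap.ker (LinearMap.toSpanSingleton A V v) := by
    intro a ha
    have ha' : ∀ i, a • b i = 0 := fun i => congrFun ha i
    have : a ∈ Module.annihilator A N := Module.mem_annihilator.2 fun n => by
      rw [← b.sum_repr n, Finset.smul_sum]
      refine Finset.sum_eq_zero fun i _ => ?_
      rw [smul_comm, ha', smul_zero]
    exact Module.mem_annihilator.1 (h this) v
  -- `A / Ann N` embeds in a finite power of `N`. That power is semisimple, so the map `a ↦ a • v`
  -- extends to all of it.
  obtain ⟨q, hq⟩ : ∃ q : (Fin (Module.finrank F N) → N) →ₗ[A] V, q (f 1) = v := by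
    obtain ⟨C, hC⟩ := exists_isCompl (LinearMap.range f)
    let g : LinearMap.range f →ₗ[A] V :=
      ((LinearMap.ker f).liftQ _ hker) ∘ₗ f.quotKerEquivRange.symm.toLinearMap
    refine ⟨g ∘ₗ (LinearMap.range f).projectionOnto C hC, ?_⟩
    have h1 : (LinearMap.range f).projectionOnto C hC (f 1) = ⟨f 1, 1, rfl⟩ :=
      Submodule.projectionOnto_apply_left hC ⟨f 1, 1, rfl⟩
    have h2 : f.quotKerEquivRange.symm ⟨f 1, 1, rfl⟩ = (LinearMap.ker f).mkQ 1 :=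
      f.quotKerEquivRange_symm_apply_image 1 _
    simp [g, h1, h2]
  obtain ⟨i, hi⟩ : ∃ i, q ∘ₗ LinearMap.single A _ i ≠ 0 := by
    by_contra! h0
    apply hv
    rw [← hq, LinearMap.pi_ext' (f := q) (g := 0) (by simpa using h0)]
    rfl
  exact ⟨LinearEquiv.ofBijective _ (LinearMap.bijective_of_ne_zero hi)⟩

variable [Module F V] [IsScalarTower F A V]

/-- A simple module `V` killed by the annihilator of `M` is either isomorphic to `M` or smaller. -/
theorem IsSimpleModule.equiv_or_finrank_lt_of_annihilator_le {M : Type*} [AddCommGroup M]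
    [Module F M] [Module A M] [IsScalarTower F A M] [Module.Finite F M]
    (h : Module.annihilator A M ≤ Module.annihilator A V) :
    Nonempty (M ≃ₗ[A] V) ∨ Module.finrank F V < Module.finrank F M := by
  obtain ⟨n, hn⟩ : ∃ n, Module.finrank F M = n := ⟨_, rfl⟩
  induction n using Nat.strong_induction_on generalizing M with
  | _ n ih =>
  have := IsSimpleModule.nontrivial A V
  have : Nontrivial M := by
    by_contra hM
    rw [not_nontrivial_iff_subsingleton] at hM
    obtain ⟨v, hv⟩ := exists_ne (0 : V)
    apply hv
    have h1 : (1 : A) ∈ Module.annihilator A M :=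
      Module.mem_annihilator.2 fun m => Subsingleton.elim _ _
    simpa using Module.mem_annihilator.1 (h h1) v
  have : IsArtinian A M := isArtinian_of_tower F inferInstance
  obtain ⟨N, hN⟩ := IsAtomic.exists_atom (Submodule A M)
  have : IsSimpleModule A N := isSimpleModule_iff_isAtom.2 hN
  have hfin : Module.Finite F N :=
    inferInstanceAs (Module.Finite F (N.restrictScalars F))
  have hfinQ : Module.Finite F (M ⧸ N) :=
    Module.Finite.of_surjective (N.mkQ.restrictScalars F) N.mkQ_surjective
  have hsum : Module.finrank F (M ⧸ N) + Module.finrank F N = Module.finrank F M :=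
    Submodule.finrank_quotient_add_finrank (N.restrictScalars F)
  have hpos : 0 < Module.finrank F N := by
    have := IsSimpleModule.nontrivial A N
    exact Module.finrank_pos
  by_cases hNV : Module.annihilator A N ≤ Module.annihilator A V
  · obtain ⟨e⟩ := IsSimpleModule.nonempty_equiv_of_annihilator_le (F := F) (V := V) hNV
    have he : Module.finrank F N = Module.finrank F V :=
      (e.restrictScalars F).finrank_eq
    rcases Nat.eq_zero_or_pos (Module.finrank F (M ⧸ N)) with h0 | h0
    · left
      have hs : Subsingleton (M ⧸ N) := Module.finrank_zero_iff.1 h0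
      have : N = ⊤ := Submodule.Quotient.subsingleton_iff.1 hs
      exact ⟨(Submodule.topEquiv.symm.trans (LinearEquiv.ofEq _ _ this.symm)).trans e⟩
    · right; omega
  · obtain ⟨a, haN, haV⟩ := SetLike.not_le_iff_exists.1 hNV
    -- `Ann V` is a prime ideal: if neither `a` nor `b` killed `V`, some product `a * c * b` would
    -- not either, yet it kills `M`, because `b` maps `M` into `N` and `a` kills `N`.
    have hQ : Module.annihilator A (M ⧸ N) ≤ Module.annihilator A V := by
      intro b hb
      by_contra hbV
      obtain ⟨v, hv⟩ : ∃ v : V, b • v ≠ 0 := by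
        by_contra! h0; exact hbV (Module.mem_annihilator.2 h0)
      apply haV
      refine Module.mem_annihilator.2 fun w => ?_
      obtain ⟨c, hc⟩ := IsSimpleModule.toSpanSingleton_surjective A hv w
      rw [← hc, LinearMap.toSpanSingleton_apply, ← mul_smul, ← mul_smul]
      refine Module.mem_annihilator.1 (h (Module.mem_annihilator.2 fun m => ?_)) v
      have hbm : b • m ∈ N := by
        rw [← Submodule.Quotient.mk_eq_zero, Submodule.Quotient.mk_smul]
        exact Module.mem_annihilator.1 hb _
      have := Module.mem_annihilator.1 haN ⟨c • b • m, N.smul_mem c hbm⟩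
      rw [mul_smul, mul_smul]
      exact congrArg Subtype.val this
    right
    rcases ih _ (by omega) hQ rfl with ⟨⟨e⟩⟩ | hlt
    · have : Module.finrank F (M ⧸ N) = Module.finrank F V := (e.restrictScalars F).finrank_eq
      omega
    · omega

variable [Module.Finite F V]

/-- **Burnside's theorem**: over an algebraically closed field, every linear endomorphism of a
finite-dimensional simple module is the action of an element of the algebra. -/
theorem IsSimpleModule.exists_smul_eq_of_isAlgClosed [IsAlgClosed F] (T : Module.End F V) :
    ∃ a : A, ∀ v, a • v = T v := by
  have hbij := IsSimpleModule.algebraMap_end_bijective_of_isAlgClosed (A := A) (V := V) F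
  -- By Schur's lemma `End_A V` consists of scalars, so `T` commutes with it and the density theorem
  -- applies.
  let f : Module.End (Module.End A V) V :=
    { T with
      map_smul' := fun e v => by
        obtain ⟨c, rfl⟩ := hbij.2 e
        simp }
  obtain ⟨s, hs⟩ := Module.Finite.fg_top (R := F) (M := V)
  obtain ⟨a, ha⟩ := jacobson_density (R := A) f s
  refine ⟨a, fun v => ?_⟩
  have hv : v ∈ Submodule.span F (s : Set V) := hs ▸ trivial
  induction hv using Submodule.span_induction with
  | mem m hm => exact (ha m hm).symm
  | zero => simp
  | add x y _ _ hx hy => rw [smul_add, hx, hy, map_add]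
  | smul c x _ hx => rw [smul_comm, hx, map_smul]

/-- A module with the same dimension and the same traces as a simple module `V` over an
algebraically closed field is isomorphic to `V`, whatever the characteristic. -/
theorem IsSimpleModule.nonempty_equiv_of_trace_eq [IsAlgClosed F] {M : Type*} [AddCommGroup M]
    [Module F M] [Module A M] [IsScalarTower F A M] [Module.Finite F M]
    (hdim : Module.finrank F M = Module.finrank F V)
    (htr : ∀ a : A, LinearMap.trace F M (Algebra.lsmul F F M a) =
      LinearMap.trace F V (Algebra.lsmul F F V a)) : Nonempty (M ≃ₗ[A] V) := by
  have hle : Module.annihilator A M ≤ Module.annihilator A V := by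
    intro a ha
    by_contra haV
    obtain ⟨v, hv⟩ : ∃ v : V, a • v ≠ 0 := by
      by_contra! h0; exact haV (Module.mem_annihilator.2 h0)
    obtain ⟨ξ, hξ⟩ : ∃ ξ : Module.Dual F V, ξ (a • v) ≠ 0 := by
      by_contra! h0; exact hv ((Module.forall_dual_apply_eq_zero_iff F _).1 h0)
    -- With `b` acting on `V` as the rank-one map `ξ(·) v`, the element `b * a` has trace `ξ (a • v)
    -- ≠ 0` on `V`, but acts as zero on `M`.
    obtain ⟨b, hb⟩ := IsSimpleModule.exists_smul_eq_of_isAlgClosed (A := A)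
      (LinearMap.toSpanSingleton F V v ∘ₗ ξ)
    have hV : Algebra.lsmul F F V (b * a) =
        LinearMap.toSpanSingleton F V v ∘ₗ (ξ ∘ₗ Algebra.lsmul F F V a) := by
      ext w; simp [hb]
    have hM : Algebra.lsmul F F M (b * a) = 0 := by
      ext m; simp [Module.mem_annihilator.1 ha m]
    have := htr (b * a)
    rw [hM, map_zero, hV, LinearMap.trace_comp_comm'] at this
    apply hξ
    have h1 : (ξ ∘ₗ Algebra.lsmul F F V a) ∘ₗ LinearMap.toSpanSingleton F V v =
        ξ (a • v) • LinearMap.id := by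
      ext; simp
    rw [h1, map_smul, LinearMap.trace_id] at this
    simpa using this.symm
  exact (IsSimpleModule.equiv_or_finrank_lt_of_annihilator_le (F := F) hle).resolve_right
    (by omega)

/-- The representation form of `IsSimpleModule.nonempty_equiv_of_trace_eq`. -/
theorem Representation.IsIrreducible.exists_equiv_of_trace_eq {G V M : Type*} [Group G]
    [IsAlgClosed F] [AddCommGroup V] [Module F V] [Module.Finite F V] [AddCommGroup M] [Module F M]
    [Module.Finite F M] (ρ : Representation F G V) (σ : Representation F G M)
    (hρ : ρ.IsIrreducible) (hdim : Module.finrank F M = Module.finrank F V)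
    (htr : ∀ g, LinearMap.trace F M (σ g) = LinearMap.trace F V (ρ g)) :
    ∃ e : M ≃ₗ[F] V, ∀ g m, e (σ g m) = ρ g (e m) := by
  have hdim' : Module.finrank F σ.asModule = Module.finrank F ρ.asModule := hdim
  have htr' (a : F[G]) : LinearMap.trace F M (σ.asAlgebraHom a) =
      LinearMap.trace F V (ρ.asAlgebraHom a) := by
    induction a using MonoidAlgebra.induction_linear with
    | zero => simp
    | add f g hf hg => simp only [map_add, hf, hg]
    | single g r => simp only [Representation.asAlgebraHom_single, map_smul, htr]
  obtain ⟨e⟩ := IsSimpleModule.nonempty_equiv_of_trace_eq (F := F) (A := F[G]) (V := ρ.asModule)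
    (M := σ.asModule) hdim' fun a => htr' a
  refine ⟨σ.asModuleEquiv.symm.trans ((e.restrictScalars F).trans ρ.asModuleEquiv), fun g m => ?_⟩
  have h1 : σ.asModuleEquiv.symm (σ g m) = MonoidAlgebra.single g (1 : F) • σ.asModuleEquiv.symm m :=
    σ.asModuleEquiv_symm_map_rho g m
  simp only [LinearEquiv.trans_apply, LinearEquiv.restrictScalars_apply, h1, map_smul]
  rw [Representation.asModuleEquiv_map_smul, Representation.asAlgebraHom_single, one_smul]

end TraceForm

/-! ### Induced representations and their traces. -/

section Induced

variable {F G W : Type*} [Field F] [Group G] {J : Subgroup G} [AddCommGroup W] [Module F W]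

namespace Representation

/-- The space of the representation of `G` induced from the representation `ρ` of `J`, realized as
a space of functions on `G`. -/
def indSpace (ρ : Representation F J W) : Submodule F (G → W) where
  carrier := {f | ∀ (x : G) (j : J), f (x * j) = ρ j⁻¹ (f x)}
  add_mem' hf hg x j := by simp [hf x j, hg x j]
  zero_mem' x j := by simp
  smul_mem' c f hf x j := by simp [hf x j]

/-- The representation of `G` induced from the representation `ρ` of `J`. -/
def indRep (ρ : Representation F J W) : Representation F G ρ.indSpace where
  toFun g :=
    { toFun := fun f => ⟨fun x => f.1 (g⁻¹ * x), fun x j => by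
        simpa only [mul_assoc] using f.2 (g⁻¹ * x) j⟩
      map_add' := fun _ _ => rfl
      map_smul' := fun _ _ => rfl }
  map_one' := by ext; simp
  map_mul' g h := by ext; simp [mul_assoc]

variable (ρ : Representation F J W)

@[simp]
theorem indRep_apply_coe (g : G) (f : ρ.indSpace) (x : G) :
    (ρ.indRep g f).1 x = f.1 (g⁻¹ * x) := rfl

theorem indSpace_apply_mul (f : ρ.indSpace) (x : G) (j : J) : f.1 (x * j) = ρ j⁻¹ (f.1 x) := f.2 x j

/-- The functions in the induced representation are determined by their values on a set of
representatives of the cosets of `J`, and these values are arbitrary. -/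
def indSpaceEquiv (s : G ⧸ J → G) (hs : ∀ c, (s c : G ⧸ J) = c) : ρ.indSpace ≃ₗ[F] (G ⧸ J → W) where
  toFun f c := f.1 (s c)
  map_add' _ _ := rfl
  map_smul' _ _ := rfl
  invFun b := ⟨fun x => ρ ⟨x⁻¹ * s x, QuotientGroup.eq.1 (hs x).symm⟩ (b x), fun x j => by
    rw [← Module.End.mul_apply, ← map_mul]
    have : ((x * j : G) : G ⧸ J) = x := by simp
    have h2 : (⟨(x * j)⁻¹ * s (x * j : G), QuotientGroup.eq.1 (hs _).symm⟩ : J) =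
        j⁻¹ * ⟨x⁻¹ * s x, QuotientGroup.eq.1 (hs x).symm⟩ := by
      ext; simp [mul_assoc]
    rw [← h2]
    simp only [this]⟩
  left_inv f := by
    ext x
    have := ρ.indSpace_apply_mul f x ⟨x⁻¹ * s x, QuotientGroup.eq.1 (hs x).symm⟩
    simp only [mul_inv_cancel_left] at this
    simp only [this, ← Module.End.mul_apply, ← map_mul, mul_inv_cancel, map_one, Module.End.one_apply]
  right_inv b := by
    funext c
    have : (⟨(s c)⁻¹ * s (s c), QuotientGroup.eq.1 (hs _).symm⟩ : J) = 1 := by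
      ext; simp [hs]
    change ρ ⟨(s c)⁻¹ * s (s c), QuotientGroup.eq.1 (hs _).symm⟩ (b (s c)) = b c
    rw [this, map_one, Module.End.one_apply, hs]

instance [Finite G] [Module.Finite F W] : Module.Finite F ρ.indSpace :=
  Module.Finite.equiv (ρ.indSpaceEquiv Quotient.out fun c => Quotient.out_eq' c).symm

theorem finrank_indSpace [Finite G] :
    Module.finrank F ρ.indSpace = J.index * Module.finrank F W := by
  have := Fintype.ofFinite (G ⧸ J)
  rw [(ρ.indSpaceEquiv Quotient.out fun c => Quotient.out_eq' c).finrank_eq]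
  rw [Subgroup.index, Nat.card_eq_fintype_card]
  by_cases hW : Module.Finite F W
  · rw [Module.finrank_pi_fintype]; simp
  · rw [Module.finrank_of_not_finite hW, mul_zero]
    refine Module.finrank_of_not_finite fun h => hW ?_
    exact Module.Finite.of_surjective (LinearMap.proj (R := F) (φ := fun _ => W) ((1 : G) : G ⧸ J))
      (LinearMap.proj_surjective _)

end Representation

theorem Multiset.sum_map_finset_sum {ι α β : Type*} [AddCommMonoid β] (f : α → β) (s : Finset ι)
    (M : ι → Multiset α) : ((∑ i ∈ s, M i).map f).sum = ∑ i ∈ s, ((M i).map f).sum := by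
  classical
  induction s using Finset.induction_on with
  | empty => simp
  | insert i s hi ih => rw [Finset.sum_insert hi, Finset.sum_insert hi, Multiset.map_add,
      Multiset.sum_add, ih]

/-- The trace of an endomorphism of a finite power is the sum of the traces of its diagonal
blocks. -/
theorem LinearMap.trace_pi_eq_sum {ι : Type*} [Fintype ι] [DecidableEq ι] [Module.Finite F W]
    (T : (ι → W) →ₗ[F] (ι → W)) : LinearMap.trace F _ T =
      ∑ i, LinearMap.trace F W (LinearMap.proj i ∘ₗ T ∘ₗ LinearMap.single F (fun _ => W) i) := by
  have h1 : T = ∑ i, (T ∘ₗ LinearMap.single F (fun _ => W) i) ∘ₗ LinearMap.proj i := by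
    refine LinearMap.ext fun f => ?_
    conv_lhs => rw [← Finset.univ_sum_single f]
    simp [map_sum]
  conv_lhs => rw [h1]
  rw [map_sum]
  exact Finset.sum_congr rfl fun i _ => LinearMap.trace_comp_comm' _ _

-- `g` permutes the blocks indexed by `G ⧸ J`, and only the blocks of fixed cosets meet the
-- diagonal.
open Classical in
theorem Representation.trace_indRep [Finite G] [Fintype (G ⧸ J)] [Module.Finite F W]
    (ρ : Representation F J W) (g : G) :
    LinearMap.trace F _ (ρ.indRep g) = ∑ c : G ⧸ J,
      if h : c.out⁻¹ * g * c.out ∈ J then LinearMap.trace F W (ρ ⟨_, h⟩) else 0 := by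
  let e := ρ.indSpaceEquiv Quotient.out fun c => Quotient.out_eq' c
  rw [← LinearMap.trace_conj' _ e, LinearMap.trace_pi_eq_sum]
  refine Finset.sum_congr rfl fun c _ => ?_
  have hblock (w : W) : (LinearMap.proj c ∘ₗ e.conj (ρ.indRep g) ∘ₗ
      LinearMap.single F (fun _ => W) c) w = ρ ⟨(g⁻¹ * c.out)⁻¹ * ((g⁻¹ * c.out : G) : G ⧸ J).out,
        QuotientGroup.eq.1 (Quotient.out_eq' _).symm⟩
        ((Pi.single c w : G ⧸ J → W) ((g⁻¹ * c.out : G) : G ⧸ J)) := by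
    simp only [LinearMap.comp_apply, LinearEquiv.conj_apply, LinearMap.proj_apply,
      LinearEquiv.coe_coe, LinearMap.coe_single]
    rfl
  split_ifs with h
  · congr 1
    refine LinearMap.ext fun w => ?_
    have hc : ((g⁻¹ * c.out : G) : G ⧸ J) = c := by
      conv_rhs => rw [← QuotientGroup.out_eq' c]
      rw [QuotientGroup.eq]
      simpa [mul_assoc] using h
    rw [hblock]
    simp only [hc, Pi.single_eq_same, mul_inv_rev, inv_inv]
  · convert map_zero (LinearMap.trace F W)
    refine LinearMap.ext fun w => ?_
    have hc : ((g⁻¹ * c.out : G) : G ⧸ J) ≠ c := by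
      intro hc
      apply h
      conv_rhs at hc => rw [← QuotientGroup.out_eq' c]
      rw [QuotientGroup.eq] at hc
      simpa [mul_assoc] using hc
    rw [hblock, Pi.single_eq_of_ne hc, map_zero, LinearMap.zero_apply]

/-- Summing a function that is constant on left cosets. -/
theorem Subgroup.sum_eq_card_mul_sum_quotient {R : Type*} [Semiring R] [Fintype G] (J : Subgroup G)
    [Fintype (G ⧸ J)] (f : G → R) (hf : ∀ x, ∀ j ∈ J, f (x * j) = f x) :
    ∑ x, f x = Nat.card J * ∑ c : G ⧸ J, f c.out := by
  have := Fintype.ofFinite J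
  have hbij : Function.Bijective (fun q : (G ⧸ J) × J => q.1.out * (q.2 : G)) := by
    constructor
    · rintro ⟨c, i⟩ ⟨d, j⟩ h
      have hcd : c = d := by
        have := congrArg (QuotientGroup.mk (s := J)) h
        simpa using this
      subst hcd
      simpa using h
    · intro x
      refine ⟨⟨x, ⟨(x : G ⧸ J).out⁻¹ * x, QuotientGroup.eq.1 (QuotientGroup.out_eq' _)⟩⟩, ?_⟩
      simp
  rw [← Fintype.sum_bijective _ hbij (fun q => f q.1.out) f fun q => (hf _ _ q.2.2).symm,
    Fintype.sum_prod_type]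
  simp [Finset.mul_sum, Nat.card_eq_fintype_card]

end Induced

/-! ### The module of `φ` is induced from that of `γ`. -/

section HuppertPair

variable {p : ℕ} {F : Type*} [Field F] {L : BrauerLift F} {G : Type*} [Group G] [Finite G]
  {φ : IBr p L G} {J : Subgroup G} {γ : IBr p L J}

theorem IsHuppertPair.degree_eq (h : IsHuppertPair φ J γ) : φ.degree = J.index * γ.degree := by
  have hF := Fintype.ofFinite G
  have h1 := congrFun h.induced_eq ⟨1, by simp⟩
  rw [← IBr.degree_eq] at h1
  have h2 : inducedBrauer J γ.toFun ⟨1, by simp⟩ = (Nat.card J : ℂ)⁻¹ * (Nat.card G * γ.degree) := by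
    unfold inducedBrauer
    congr 1
    rw [finsum_eq_sum_of_fintype, Nat.card_eq_fintype_card, ← nsmul_eq_mul, ← Finset.card_univ,
      ← Finset.sum_const]
    refine Finset.sum_congr rfl fun x _ => ?_
    rw [γ.degree_eq]
    have hx : x * 1 * x⁻¹ = 1 := by simp
    simp only [hx, J.one_mem, dite_true]
    rfl
  rw [h2, ← J.card_mul_index] at h1
  have hJ : (Nat.card J : ℂ) ≠ 0 := Nat.cast_ne_zero.2 Nat.card_pos.ne'
  push_cast at h1
  rw [mul_assoc, inv_mul_cancel_left₀ hJ] at h1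
  exact_mod_cast h1.symm

-- Summing over cosets removes the factor `|J|⁻¹`, so the value becomes the lift of an honest
-- multiset of roots of unity and can be reduced to `F` even when `p` divides `|J|`.
open Classical in
theorem inducedBrauer_eq_sum_quotient [Fintype (G ⧸ J)] (γ : IBr p L J) (g : PRegular p G) :
    inducedBrauer J γ.toFun g = ∑ c : G ⧸ J, ((if h : c.out⁻¹ * g.1 * c.out ∈ J then
      (γ.rep ⟨_, h⟩).charpoly.roots else 0).map L.toHom).sum := by
  have hF := Fintype.ofFinite G
  have hJ : (Nat.card J : ℂ) ≠ 0 := Nat.cast_ne_zero.2 Nat.card_pos.ne'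
  let M : G → Multiset F := fun y => if h : y ∈ J then (γ.rep ⟨y, h⟩).charpoly.roots else 0
  have hM : ∀ y, ∀ j ∈ J, M (j⁻¹ * y * j) = M y := by
    intro y j hj
    by_cases hy : y ∈ J
    · have hy' : j⁻¹ * y * j ∈ J := J.mul_mem (J.mul_mem (J.inv_mem hj) hy) hj
      simp only [M, dif_pos hy, dif_pos hy']
      congr 1
      let e : (Fin γ.degree → F) ≃ₗ[F] (Fin γ.degree → F) :=
        LinearEquiv.ofLinearMap (γ.rep ⟨j, hj⟩⁻¹) (γ.rep ⟨j, hj⟩)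
          (by rw [← Module.End.mul_eq_comp, ← map_mul, inv_mul_cancel, map_one]; rfl)
          (by rw [← Module.End.mul_eq_comp, ← map_mul, mul_inv_cancel, map_one]; rfl)
      rw [← LinearEquiv.charpoly_conj e (γ.rep ⟨y, hy⟩)]
      congr 1
      have : (⟨j⁻¹ * y * j, hy'⟩ : J) = ⟨j, hj⟩⁻¹ * ⟨y, hy⟩ * ⟨j, hj⟩ := rfl
      rw [this, map_mul, map_mul]
      rfl
    · have hy' : j⁻¹ * y * j ∉ J := fun h => hy <| by
        simpa [mul_assoc] using J.mul_mem (J.mul_mem hj h) (J.inv_mem hj)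
      simp only [M, dif_neg hy, dif_neg hy']
  unfold inducedBrauer
  -- Inverting `x` turns `x g x⁻¹` into `x⁻¹ g x`, the form adapted to left cosets `xJ`.
  rw [finsum_eq_sum_of_fintype, ← Equiv.sum_comp (Equiv.inv G)]
  have h1 : ∀ x : G, (if h : (Equiv.inv G) x * g.1 * ((Equiv.inv G) x)⁻¹ ∈ J then
      γ.toFun ⟨⟨(Equiv.inv G) x * g.1 * ((Equiv.inv G) x)⁻¹, h⟩, by
        rw [Subgroup.orderOf_mk, ← MulAut.conj_apply, MulEquiv.orderOf_eq]; exact g.2⟩ else 0) =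
      ((M (x⁻¹ * g.1 * x)).map L.toHom).sum := by
    intro x
    by_cases hx : x⁻¹ * g.1 * x ∈ J
    · have hx' : (Equiv.inv G) x * g.1 * ((Equiv.inv G) x)⁻¹ ∈ J := by simpa using hx
      rw [dif_pos hx', ← γ.brauerCharacter_rep]
      simp only [M, dif_pos hx, brauerCharacter]
      simp
    · have hx' : ¬ (Equiv.inv G) x * g.1 * ((Equiv.inv G) x)⁻¹ ∈ J := by simpa using hx
      simp only [M, dif_neg hx', dif_neg hx, Multiset.map_zero, Multiset.sum_zero]
  rw [Finset.sum_congr rfl fun x _ => h1 x, J.sum_eq_card_mul_sum_quotient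
    (fun x => ((M (x⁻¹ * g.1 * x)).map L.toHom).sum), inv_mul_cancel_left₀ hJ]
  intro x j hj
  have := hM (x⁻¹ * g.1 * x) j hj
  simp only [mul_inv_rev]
  rw [← this]
  simp only [mul_assoc]

variable [Fact p.Prime] [IsAlgClosed F] [CharP F p]

/-- Both traces depend only on the `p`-regular part of `g`. There they are sums of eigenvalues whose
lifts agree by `γ^G = φ`. -/
theorem IsHuppertPair.trace_indRep (h : IsHuppertPair φ J γ) (g : G) :
    LinearMap.trace F _ (γ.rep.indRep g) = LinearMap.trace F _ (φ.rep g) := by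
  classical
  have hF := Fintype.ofFinite (G ⧸ J)
  obtain ⟨k, a, hk, hka⟩ := exists_pow_coprime_orderOf (p := p) g
  rw [Representation.trace_eq_of_pow_char_pow_eq p _ (Commute.self_pow g k) hka,
    Representation.trace_eq_of_pow_char_pow_eq p _ (Commute.self_pow g k) hka]
  generalize g ^ k = g at hk
  have hn : ((orderOf g : ℕ) : F) ≠ 0 := by
    rw [Ne, CharP.cast_eq_zero_iff F p]
    exact (Nat.Prime.coprime_iff_not_dvd Fact.out).1 hk.symm
  have hchar := congrFun h.induced_eq ⟨g, hk⟩
  rw [← φ.brauerCharacter_rep, inducedBrauer_eq_sum_quotient γ ⟨g, hk⟩,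
    ← Multiset.sum_map_finset_sum] at hchar
  have key := L.sum_eq_of_sum_map_eq hn (fun b hb => ?_)
    (fun b hb => φ.rep.pow_eq_one_of_mem_roots_charpoly (pow_orderOf_eq_one g) hb) hchar
  · have hφ : LinearMap.trace F _ (φ.rep g) = (φ.rep g).charpoly.roots.sum :=
      Module.End.trace_eq_sum_roots_charpoly_of_splits (IsAlgClosed.splits _)
    rw [hφ, ← key, Representation.trace_indRep]
    have := Multiset.sum_map_finset_sum (AddMonoidHom.id F) Finset.univ
      fun c : G ⧸ J => if h : c.out⁻¹ * g * c.out ∈ J then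
        (γ.rep ⟨_, h⟩).charpoly.roots else 0
    simp only [AddMonoidHom.id_apply, Multiset.map_id'] at this
    rw [this]
    refine Finset.sum_congr rfl fun c _ => ?_
    split_ifs with hc
    · exact Module.End.trace_eq_sum_roots_charpoly_of_splits (IsAlgClosed.splits _)
    · rfl
  · obtain ⟨c, -, hc⟩ := Multiset.mem_sum.1 hb
    split_ifs at hc with hcJ
    · refine γ.rep.pow_eq_one_of_mem_roots_charpoly ?_ hc
      ext
      have := conj_pow (i := orderOf g) (a := c.out⁻¹) (b := g)
      rw [inv_inv, pow_orderOf_eq_one] at this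
      simpa using this
    · simp at hc

/-- The representation affording `φ` is induced from the one affording `γ`. -/
theorem IsHuppertPair.exists_equiv (h : IsHuppertPair φ J γ) :
    ∃ e : γ.rep.indSpace ≃ₗ[F] (Fin φ.degree → F), ∀ g f, e (γ.rep.indRep g f) = φ.rep g (e f) :=
  Representation.IsIrreducible.exists_equiv_of_trace_eq _ _ φ.rep_irreducible
    (by rw [Representation.finrank_indSpace, h.degree_eq]; simp) h.trace_indRep

end HuppertPair

/-! ### Hall `p'`-subgroups of `p`-solvable groups. -/

section HallSubgroup

variable {p : ℕ} {G : Type*} [Group G]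

theorem Subgroup.relIndex_dvd_relIndex_of_normal_of_le {A B C : Subgroup G} [A.Normal]
    (h : B ≤ C) : A.relIndex B ∣ A.relIndex C := by
  have := (A.subgroupOf C).relIndex_dvd_index_of_normal (B.subgroupOf C)
  rwa [Subgroup.relIndex_subgroupOf h] at this

/-- Intersect the series with `J`: the order of each new factor divides that of the old one. -/
theorem IsPSolvable.subgroup [Fact p.Prime] (h : IsPSolvable p G) (J : Subgroup G) :
    IsPSolvable p J := by
  obtain ⟨n, N, h0, hn, hN, hstep⟩ := h
  refine ⟨n, fun i => (N i).subgroupOf J, ?_, ?_, fun i => ?_, fun i hi => ⟨?_, ?_⟩⟩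
  · simp [h0]
  · simp [hn]
  · have := hN i
    infer_instance
  · exact Subgroup.comap_mono (hstep i hi).1
  · have := hN i
    have hdvd : ((N i).subgroupOf J).relIndex ((N (i + 1)).subgroupOf J) ∣
        (N i).relIndex (N (i + 1)) := by
      rw [← Subgroup.inf_subgroupOf_right (N (i + 1)), Subgroup.relIndex_subgroupOf inf_le_right]
      exact Subgroup.relIndex_dvd_relIndex_of_normal_of_le inf_le_left
    rcases (hstep i hi).2 with ⟨k, hk⟩ | hk
    · rw [hk] at hdvd
      obtain ⟨l, -, hl⟩ := (Nat.dvd_prime_pow Fact.out).1 hdvd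
      exact Or.inl ⟨l, hl⟩
    · exact Or.inr (hk.coprime_dvd_left hdvd)

/-- If `K ≤ N` are normal, `N / K` is a `p`-group and `H / N` is a `p'`-group then `H / K` has a
`p`-complement. -/
theorem exists_le_relIndex_coprime [Finite G] {K N H : Subgroup G} [K.Normal] [N.Normal]
    (hKN : K ≤ N) (hNH : N ≤ H) (hcop : (K.relIndex N).Coprime (N.relIndex H)) :
    ∃ H' : Subgroup G, K ≤ H' ∧ H'.index = K.relIndex N * H.index ∧
      K.relIndex H' = N.relIndex H := by
  let π := QuotientGroup.mk' (K.subgroupOf H)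
  have hπ : Function.Surjective π := QuotientGroup.mk'_surjective _
  let M := (N.subgroupOf H).map π
  have hMn : M.Normal := Subgroup.Normal.map inferInstance π hπ
  have hMi : M.index = N.relIndex H := by
    refine Subgroup.index_map_eq _ hπ ?_
    rw [QuotientGroup.ker_mk']
    exact Subgroup.comap_mono hKN
  have hmul : K.relIndex N * N.relIndex H = K.relIndex H := Subgroup.relIndex_mul_relIndex K N H hKN hNH
  have hpos : 0 < N.relIndex H := Nat.pos_of_ne_zero (Subgroup.index_ne_zero_of_finite)
  have hMc : Nat.card M = K.relIndex N := by
    have h1 : Nat.card M * M.index = K.relIndex H := M.card_mul_index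
    rw [hMi, ← hmul] at h1
    exact Nat.eq_of_mul_eq_mul_right hpos h1
  -- Schur–Zassenhaus in `H / K`; the preimage of the complement is the required subgroup.
  obtain ⟨C, hC⟩ := Subgroup.exists_right_complement'_of_coprime (N := M) (by rwa [hMc, hMi])
  have hle : K ≤ (C.comap π).map H.subtype := by
    intro x hx
    refine ⟨⟨x, hNH (hKN hx)⟩, ?_, rfl⟩
    have : π ⟨x, hNH (hKN hx)⟩ = 1 := (QuotientGroup.eq_one_iff _).2 hx
    rw [SetLike.mem_coe, Subgroup.mem_comap, this]
    exact C.one_mem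
  have hidx : ((C.comap π).map H.subtype).index = K.relIndex N * H.index := by
    rw [Subgroup.index_map_subtype, Subgroup.index_comap_of_surjective _ hπ, hC.index_eq_card, hMc]
  refine ⟨_, hle, hidx, ?_⟩
  have h1 := Subgroup.relIndex_mul_index hle
  rw [hidx, ← Subgroup.relIndex_mul_index (hKN.trans hNH), ← hmul, mul_comm (K.relIndex N) (N.relIndex H),
    mul_assoc] at h1
  have hH : 0 < H.index := Nat.pos_of_ne_zero Subgroup.index_ne_zero_of_finite
  have hK : 0 < K.relIndex N := Nat.pos_of_ne_zero Subgroup.index_ne_zero_of_finite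
  exact Nat.eq_of_mul_eq_mul_right (Nat.mul_pos hK hH) h1

/-- A finite `p`-solvable group has a Hall `p'`-subgroup. -/
theorem IsPSolvable.exists_coprime_card_index_eq_pow [Fact p.Prime] [Finite G]
    (h : IsPSolvable p G) :
    ∃ H : Subgroup G, (Nat.card H).Coprime p ∧ ∃ k, H.index = p ^ k := by
  obtain ⟨n, N, h0, hn, hN, hstep⟩ := h
  have key : ∃ H : Subgroup G, N 0 ≤ H ∧ ((N 0).relIndex H).Coprime p ∧ ∃ k, H.index = p ^ k := by
    -- Descend from `G`: a `p'`-factor is absorbed into `H / N i`, while a `p`-factor is split off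
    -- by passing to a complement.
    refine Nat.decreasingInduction (motive := fun i _ => ∃ H : Subgroup G, N i ≤ H ∧
      ((N i).relIndex H).Coprime p ∧ ∃ k, H.index = p ^ k) ?_ ?_ (Nat.zero_le n)
    · rintro i hi ⟨H, hle, hcop, k, hk⟩
      have := hN i
      have := hN (i + 1)
      obtain ⟨hi1, ⟨l, hl⟩ | hl⟩ := hstep i hi
      · obtain ⟨H', h1, h2, h3⟩ := exists_le_relIndex_coprime hi1 hle
          (by rw [hl]; exact (hcop.symm.pow_left l))
        exact ⟨H', h1, h3 ▸ hcop, l + k, by rw [h2, hl, hk, pow_add]⟩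
      · refine ⟨H, hi1.trans hle, ?_, k, hk⟩
        rw [← Subgroup.relIndex_mul_relIndex _ _ _ hi1 hle]
        exact Nat.Coprime.mul_left hl hcop
    · exact ⟨⊤, le_top, by simp [hn], 0, by simp⟩
  obtain ⟨H, -, h2, h3⟩ := key
  exact ⟨H, by rwa [h0, Subgroup.relIndex_bot_left] at h2, h3⟩

end HallSubgroup

/-! ### Orbits of `P` on `G / J`. -/

section OrbitCount

variable {p : ℕ} {G : Type*} [Group G]

theorem mem_conjSubgroup {P : Subgroup G} {x y : G} : y ∈ conjSubgroup P x ↔ x * y * x⁻¹ ∈ P := by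
  unfold conjSubgroup
  rw [Subgroup.mem_map]
  constructor
  · rintro ⟨g, hg, rfl⟩
    simpa [mul_assoc] using hg
  · intro h
    exact ⟨_, h, by simp [mul_assoc]⟩

/-- The stabilizer in `P` of the coset `xJ` is conjugate to `P^x ∩ J`. -/
theorem card_stabilizer_quotient (P J : Subgroup G) (x : G) :
    Nat.card (MulAction.stabilizer P (x : G ⧸ J)) =
      Nat.card ((conjSubgroup P x).subgroupOf J) := by
  have key (g : P) : g ∈ MulAction.stabilizer P (x : G ⧸ J) ↔ x⁻¹ * g * x ∈ J := by
    rw [MulAction.mem_stabilizer_iff]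
    change ((g * x : G) : G ⧸ J) = x ↔ _
    rw [eq_comm, QuotientGroup.eq, mul_assoc]
  refine Nat.card_congr
    { toFun := fun g => ⟨⟨x⁻¹ * g.1 * x, (key g.1).1 g.2⟩, ?_⟩
      invFun := fun j => ⟨⟨x * j.1 * x⁻¹, ?_⟩, ?_⟩
      left_inv := ?_
      right_inv := ?_ }
  · rw [Subgroup.mem_subgroupOf, mem_conjSubgroup]
    simp [mul_assoc]
  · exact mem_conjSubgroup.1 (Subgroup.mem_subgroupOf.1 j.2)
  · rw [key]
    simp [mul_assoc]
  · intro g; ext; simp [mul_assoc]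
  · intro j; ext; simp [mul_assoc]

theorem isPGroup_conjSubgroup_subgroupOf {P : Subgroup G} (hP : IsPGroup p P) (J : Subgroup G)
    (x : G) : IsPGroup p ((conjSubgroup P x).subgroupOf J) :=
  (hP.map _).comap_of_injective _ J.subtype_injective

/-- If `P^x ∩ J ≤ K` for all `x` then `P` permutes a transversal of `J` up to elements of `K`. -/
theorem exists_section_mul_eq (P : Subgroup G) {J : Subgroup G} (K : Subgroup J)
    (hK : ∀ x, (conjSubgroup P x).subgroupOf J ≤ K) :
    ∃ s : G ⧸ J → G, (∀ c, (s c : G ⧸ J) = c) ∧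
      ∀ g ∈ P, ∀ c, ∃ k ∈ K, g * s c = s (g • c) * (k : G) := by
  -- `r` chooses one element per orbit, and each coset is then represented by a `P`-translate `t c *
  -- r c`. The discrepancy `k` thus lies in `P^(r c) ∩ J`.
  let r : G ⧸ J → G := fun c =>
    (Quotient.mk'' c : MulAction.orbitRel.Quotient P (G ⧸ J)).out.out
  have hr : ∀ c : G ⧸ J, ∃ g : P, g • (r c : G ⧸ J) = c := fun c => by
    have h : (r c : G ⧸ J) ∈ MulAction.orbit P c := by
      rw [QuotientGroup.out_eq']
      exact MulAction.orbitRel_apply.1 (Quotient.mk_out (s := MulAction.orbitRel P (G ⧸ J)) c)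
    exact MulAction.mem_orbit_symm.1 h
  choose t ht using hr
  refine ⟨fun c => t c * r c, fun c => ht c, fun g hg c => ?_⟩
  have hgc : r (g • c) = r c := by
    simp only [r]
    congr 2
    exact Quotient.sound' ⟨⟨g, hg⟩, rfl⟩
  have hmem : (t (g • c) * r (g • c))⁻¹ * (g * (t c * r c)) ∈ J := by
    rw [← QuotientGroup.eq]
    refine (ht (g • c)).trans ?_
    conv_lhs => rw [← ht c]
    rfl
  refine ⟨⟨_, hmem⟩, hK (r c) ?_, by simp [mul_assoc]⟩
  rw [Subgroup.mem_subgroupOf, mem_conjSubgroup]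
  simp only [hgc, mul_inv_rev, mul_assoc, mul_inv_cancel_left, mul_inv_cancel, mul_one]
  exact P.mul_mem (P.inv_mem (t (g • c)).2) (P.mul_mem hg (t c).2)

variable [Fact p.Prime] [Finite G]

theorem IsPGroup.exists_sylow_eq_iff {Q : Subgroup G} (hQ : IsPGroup p Q) :
    (∃ S : Sylow p G, (S : Subgroup G) = Q) ↔ Nat.card Q = ordProj[p] (Nat.card G) := by
  constructor
  · rintro ⟨S, rfl⟩
    exact S.card_eq_multiplicity
  · intro h
    exact ⟨Sylow.ofCard Q h, rfl⟩

theorem IsPGroup.card_le_ordProj {Q : Subgroup G} (hQ : IsPGroup p Q) :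
    Nat.card Q ≤ ordProj[p] (Nat.card G) := by
  obtain ⟨k, hk⟩ := IsPGroup.iff_card.1 hQ
  refine Nat.le_of_dvd (Nat.ordProj_pos _ _) ?_
  rw [hk]
  refine pow_dvd_pow p ?_
  rw [← (Fact.out : p.Prime).pow_dvd_iff_le_factorization Nat.card_pos.ne', ← hk]
  exact Q.card_subgroup_dvd_card

theorem ordProj_index_mul_ordProj_card (p : ℕ) (J : Subgroup G) :
    ordProj[p] J.index * ordProj[p] (Nat.card J) = ordProj[p] (Nat.card G) := by
  rw [← J.card_mul_index, Nat.factorization_mul Nat.card_pos.ne' Subgroup.index_ne_zero_of_finite,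
    Finsupp.add_apply, pow_add, mul_comm]

/-- Orbit–stabilizer, with `|P| = |G|_p = |G:J|_p |J|_p`. Since `P^x ∩ J` has order at most `|J|_p`,
the orbit has length at least `|G:J|_p`, with equality exactly in the Sylow case. -/
theorem card_orbit_quotient_mul (P : Sylow p G) (J : Subgroup G) (x : G) :
    Nat.card (MulAction.orbit P (x : G ⧸ J)) *
      Nat.card ((conjSubgroup (P : Subgroup G) x).subgroupOf J) =
      ordProj[p] J.index * ordProj[p] (Nat.card J) := by
  rw [ordProj_index_mul_ordProj_card, ← P.card_eq_multiplicity, ← card_stabilizer_quotient,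
    ← Nat.card_prod]
  exact Nat.card_congr (MulAction.orbitProdStabilizerEquivGroup P (x : G ⧸ J))

theorem ordProj_index_le_card_orbit (P : Sylow p G) (J : Subgroup G) (x : G) :
    ordProj[p] J.index ≤ Nat.card (MulAction.orbit P (x : G ⧸ J)) := by
  have h1 := card_orbit_quotient_mul P J x
  have h2 := (isPGroup_conjSubgroup_subgroupOf P.isPGroup' J x).card_le_ordProj
  refine Nat.le_of_mul_le_mul_right (c := ordProj[p] (Nat.card J)) ?_ (Nat.ordProj_pos _ _)
  rw [← h1]
  exact Nat.mul_le_mul_left _ h2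

theorem card_orbit_eq_ordProj_index_iff (P : Sylow p G) (J : Subgroup G) (x : G) :
    Nat.card (MulAction.orbit P (x : G ⧸ J)) = ordProj[p] J.index ↔
      ∃ S : Sylow p J, (S : Subgroup J) = (conjSubgroup (P : Subgroup G) x).subgroupOf J := by
  rw [(isPGroup_conjSubgroup_subgroupOf P.isPGroup' J x).exists_sylow_eq_iff]
  have h1 := card_orbit_quotient_mul P J x
  constructor
  · intro h
    rw [h] at h1
    exact Nat.eq_of_mul_eq_mul_left (Nat.ordProj_pos _ _) h1
  · intro h
    rw [h] at h1
    exact Nat.eq_of_mul_eq_mul_right (Nat.ordProj_pos _ _) h1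

theorem sum_card_orbit_quotient (P J : Subgroup G) [Fintype (MulAction.orbitRel.Quotient P (G ⧸ J))] :
    ∑ o : MulAction.orbitRel.Quotient P (G ⧸ J),
      Nat.card (MulAction.orbit P ((o.out.out : G) : G ⧸ J)) = J.index := by
  rw [Subgroup.index, Nat.card_congr (MulAction.selfEquivSigmaOrbits P (G ⧸ J)), Nat.card_sigma]
  refine Finset.sum_congr rfl fun o _ => ?_
  rw [QuotientGroup.out_eq']

/-- The number of `P`-orbits on `G / J` is at most the `p'`-part of `|G : J|`. -/
theorem card_orbitRel_quotient_le (P : Sylow p G) (J : Subgroup G) :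
    Nat.card (MulAction.orbitRel.Quotient P (G ⧸ J)) ≤ ordCompl[p] J.index := by
  have := Fintype.ofFinite (MulAction.orbitRel.Quotient P (G ⧸ J))
  have h1 := sum_card_orbit_quotient (P : Subgroup G) J
  rw [← Nat.ordProj_mul_ordCompl_eq_self J.index p] at h1
  refine Nat.le_of_mul_le_mul_left (c := ordProj[p] J.index) ?_ (Nat.ordProj_pos _ _)
  rw [← h1, Nat.card_eq_fintype_card, ← Finset.card_univ, mul_comm, ← smul_eq_mul,
    ← Finset.sum_const]
  exact Finset.sum_le_sum fun o _ => ordProj_index_le_card_orbit P J _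

/-- The number of `P`-orbits on `G / J` is the `p'`-part of `|G : J|` if and only if all conjugates
of `P` intersect `J` in a Sylow subgroup. -/
theorem card_orbitRel_quotient_eq_iff (P : Sylow p G) (J : Subgroup G) :
    Nat.card (MulAction.orbitRel.Quotient P (G ⧸ J)) = ordCompl[p] J.index ↔
      ∀ x : G, ∃ S : Sylow p J,
        (S : Subgroup J) = (conjSubgroup (P : Subgroup G) x).subgroupOf J := by
  have := Fintype.ofFinite (MulAction.orbitRel.Quotient P (G ⧸ J))
  have h1 := sum_card_orbit_quotient (P : Subgroup G) J
  have h2 : ∑ o : MulAction.orbitRel.Quotient P (G ⧸ J), ordProj[p] J.index =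
      ordProj[p] J.index * Nat.card (MulAction.orbitRel.Quotient P (G ⧸ J)) := by
    rw [Finset.sum_const, smul_eq_mul, Finset.card_univ, Nat.card_eq_fintype_card, mul_comm]
  have h3 : Nat.card (MulAction.orbitRel.Quotient P (G ⧸ J)) = ordCompl[p] J.index ↔
      ∑ o : MulAction.orbitRel.Quotient P (G ⧸ J), ordProj[p] J.index =
      ∑ o : MulAction.orbitRel.Quotient P (G ⧸ J),
        Nat.card (MulAction.orbit P ((o.out.out : G) : G ⧸ J)) := by
    rw [h2, h1]
    conv_rhs =>
      rhs
      rw [← Nat.ordProj_mul_ordCompl_eq_self J.index p]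
    exact (Nat.mul_right_inj (Nat.ordProj_pos _ _).ne').symm
  rw [h3, Finset.sum_eq_sum_iff_of_le fun o _ => ordProj_index_le_card_orbit P J _]
  constructor
  · intro h x
    rw [← card_orbit_eq_ordProj_index_iff]
    rw [h (Quotient.mk'' (x : G ⧸ J)) (Finset.mem_univ _), QuotientGroup.out_eq']
    congr 2
    exact (MulAction.orbit_eq_iff.2 (MulAction.orbitRel_apply.1 (Quotient.mk_out (x : G ⧸ J)))).symm
  · intro h o _
    exact ((card_orbit_eq_ordProj_index_iff P J _).2 (h _)).symm

/-- The image of `Q` in the quotient by `K` is a `p`-group in a `p'`-group. This is how `P^x ∩ J`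
comes to lie in `Ker γ`. -/
theorem IsPGroup.le_of_not_dvd_index {Q K : Subgroup G} [K.Normal] (hQ : IsPGroup p Q)
    (hK : ¬ p ∣ K.index) : Q ≤ K := by
  rw [← Subgroup.relIndex_eq_one]
  obtain ⟨k, hk⟩ := IsPGroup.iff_card.1 hQ
  have h1 := (K.relIndex_dvd_card Q)
  rw [hk] at h1
  have h2 : (p ^ k).Coprime K.index :=
    ((Nat.Prime.coprime_iff_not_dvd Fact.out).2 hK).pow_left k
  exact Nat.eq_one_of_dvd_coprimes h2 h1 (K.relIndex_dvd_index_of_normal Q)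

end OrbitCount

/-! ### Fixed points of `p`-groups in characteristic `p`. -/

section FixedPoints

variable {p : ℕ} [Fact p.Prime] {F : Type*} [Field F] [CharP F p] {P : Type*} [Group P]

/-- A `p`-group has a nonzero fixed vector in every nonzero subrepresentation in
characteristic `p`. -/
theorem IsPGroup.exists_ne_zero_forall_apply_eq [Finite P] (hP : IsPGroup p P) {M : Type*} [AddCommGroup M]
    [Module F M] (τ : Representation F P M) {D : Submodule F M} (hD : ∀ g, ∀ m ∈ D, τ g m ∈ D)
    (hne : D ≠ ⊥) : ∃ m ∈ D, m ≠ 0 ∧ ∀ g, τ g m = m := by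
  obtain ⟨w, hw, hw0⟩ := Submodule.exists_mem_ne_zero_of_ne_bot hne
  have hpM (m : M) : p • m = 0 := by
    rw [← Nat.cast_smul_eq_nsmul F, CharP.cast_eq_zero, zero_smul]
  have hmod : Module (ZMod p) M := AddCommGroup.zmodModule hpM
  -- The span over the prime field of one orbit is finite even when `F` is infinite, so fixed points
  -- can be counted modulo `p`.
  let S : Submodule (ZMod p) M := Submodule.span (ZMod p) (Set.range fun g : P => τ g w)
  have hSfin : Finite ↥S := by
    have : Module.Finite (ZMod p) S := Module.Finite.span_of_finite _ (Set.finite_range _)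
    exact Module.finite_of_finite (ZMod p)
  have hSτ : ∀ g, ∀ m ∈ S, τ g m ∈ S := by
    intro g m hm
    refine Submodule.span_induction (p := fun m _ => τ g m ∈ S) ?_ ?_ ?_ ?_ hm
    · rintro _ ⟨h, rfl⟩
      refine Submodule.subset_span ⟨g * h, ?_⟩
      simp
    · rw [map_zero]; exact S.zero_mem
    · intro x y _ _ hx hy
      rw [map_add]; exact S.add_mem hx hy
    · intro c x _ hx
      rw [ZMod.map_smul (τ g)]
      exact S.smul_mem c hx
  have hSD : ∀ m ∈ S, m ∈ D := by
    intro m hm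
    refine Submodule.span_induction (p := fun m _ => m ∈ D) ?_ D.zero_mem
      (fun x y _ _ => D.add_mem) ?_ hm
    · rintro _ ⟨h, rfl⟩
      exact hD h w hw
    · intro c x _ hx
      have : c • x = c.val • x := by
        conv_lhs => rw [← ZMod.natCast_zmod_val c]
        exact Nat.cast_smul_eq_nsmul _ _ _
      rw [this]
      exact D.smul_of_tower_mem c.val hx
  have hwS : w ∈ S := Submodule.subset_span ⟨1, by simp⟩
  let _ : MulAction P S :=
    { smul := fun g m => ⟨τ g m, hSτ g m m.2⟩
      one_smul := fun m => Subtype.ext (by change τ 1 m.1 = m.1; simp)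
      mul_smul := fun g h m => Subtype.ext (by change τ (g * h) m.1 = τ g (τ h m.1); simp) }
  have hdvd : p ∣ Nat.card S := by
    have h1 : addOrderOf (⟨w, hwS⟩ : S) = p :=
      addOrderOf_eq_prime (Subtype.ext (hpM w)) fun h => hw0 (congrArg Subtype.val h)
    exact h1.symm.dvd.trans (addOrderOf_dvd_natCard _)
  have h0 : (0 : S) ∈ MulAction.fixedPoints P S := fun g => Subtype.ext (map_zero (τ g))
  obtain ⟨m, hm, hm0⟩ := hP.exists_fixed_point_of_prime_dvd_card_of_fixed_point S hdvd h0
  exact ⟨m, hSD m m.2, fun h => hm0 (Subtype.ext h.symm), fun g => congrArg Subtype.val (hm g)⟩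

/-- Nakayama's lemma for a free module `P → E` over the group algebra of a `p`-group: a
submodule which maps onto the coinvariants `E` is everything. -/
theorem IsPGroup.eq_top_of_sum_surjective [Fintype P] (hP : IsPGroup p P) {E : Type*}
    [AddCommGroup E] [Module F E] [Module.Finite F E] {N : Submodule F (P → E)}
    (hN : ∀ g : P, ∀ f ∈ N, (fun x => f (g⁻¹ * x)) ∈ N) (hsum : ∀ e, ∃ f ∈ N, ∑ x, f x = e) :
    N = ⊤ := by
  classical
  let τ : Representation F P (Module.Dual F (P → E)) :=
    { toFun := fun g => Module.Dual.transpose (LinearMap.funLeft F E fun x => g * x)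
      map_one' := by ext; simp [Module.Dual.transpose, LinearMap.funLeft]; rfl
      map_mul' := fun g h => by
        ext ξ f
        simp [Module.Dual.transpose, LinearMap.funLeft, Function.comp_def, mul_assoc] }
  have hτ (g : P) (ξ : Module.Dual F (P → E)) (f : P → E) : τ g ξ f = ξ fun x => f (g * x) := rfl
  by_contra hne
  have hD : N.dualAnnihilator ≠ ⊥ := fun h => hne <| by
    rw [← Subspace.dualAnnihilator_dualCoannihilator_eq (W := N), h,
      Submodule.dualCoannihilator_bot]
  -- If `N` were proper, some nonzero `P`-invariant functional would vanish on it. Invariance makes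
  -- the functional factor through `f ↦ ∑ x, f x`, which is already onto from `N`.
  obtain ⟨ξ, hξN, hξ0, hξ⟩ := hP.exists_ne_zero_forall_apply_eq τ (D := N.dualAnnihilator)
    (fun g ξ hξ => (Submodule.mem_dualAnnihilator _).2 fun f hf => by
      rw [hτ]
      have := hN g⁻¹ f hf
      rw [inv_inv] at this
      exact (Submodule.mem_dualAnnihilator _).1 hξ _ this) hD
  have h1 (x : P) (e : E) : ξ (Pi.single x e) = ξ (Pi.single 1 e) := by
    conv_lhs => rw [← hξ x]
    rw [hτ]
    congr 1
    funext y
    by_cases hy : y = 1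
    · subst hy; simp
    · rw [Pi.single_eq_of_ne hy, Pi.single_eq_of_ne (by simpa using hy)]
  have h2 (f : P → E) : ξ f = ξ (Pi.single 1 (∑ x, f x)) := by
    conv_lhs => rw [← Finset.univ_sum_single f]
    rw [map_sum, Finset.sum_congr rfl fun x _ => h1 x (f x), ← map_sum]
    congr 1
    exact (map_sum (AddMonoidHom.single (fun _ : P => E) 1) f Finset.univ).symm
  apply hξ0
  refine LinearMap.ext fun f => ?_
  obtain ⟨f', hf', hff'⟩ := hsum (∑ x, f x)
  rw [h2, ← hff', ← h2]
  exact (Submodule.mem_dualAnnihilator _).1 hξN f' hf'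

end FixedPoints

/-! ### Bounds for dimensions of projective modules. -/

section ProjectiveBounds

variable {F : Type*} [Field F] {G : Type*} [Group G]

/-- The `F[G]`-linear map defined by an equivariant linear map to a representation. -/
theorem Representation.exists_linearMap_asModule {V : Type*} [AddCommGroup V] [Module F V]
    (ρ : Representation F G V) {Q : Type*} [AddCommGroup Q] [Module F Q] [Module F[G] Q]
    [IsScalarTower F F[G] Q] (f : Q →ₗ[F] V)
    (hf : ∀ g z, f (MonoidAlgebra.single g (1 : F) • z) = ρ g (f z)) :
    ∃ f' : Q →ₗ[F[G]] ρ.asModule, ∀ z, ρ.asModuleEquiv (f' z) = f z := by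
  refine ⟨MonoidAlgebra.equivariantOfLinearOfComm (ρ.asModuleEquiv.symm.toLinearMap ∘ₗ f)
    fun g z => ?_, fun z => ?_⟩
  · simp only [LinearMap.comp_apply, LinearEquiv.coe_coe, hf]
    exact ρ.asModuleEquiv_symm_map_rho g (f z)
  · simp

theorem Representation.asModuleEquiv_map_single_smul {V : Type*} [AddCommGroup V] [Module F V]
    (ρ : Representation F G V) (g : G) (v : ρ.asModule) :
    ρ.asModuleEquiv (MonoidAlgebra.single g (1 : F) • v) = ρ g (ρ.asModuleEquiv v) := by
  rw [ρ.asModuleEquiv_map_smul, Representation.asAlgebraHom_single, one_smul]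

/-- The lifting property of projective modules, for maps to representations. -/
theorem Module.Projective.exists_lift_representation {Q : Type*} [AddCommGroup Q] [Module F Q]
    [Module F[G] Q] [IsScalarTower F F[G] Q] [Module.Projective F[G] Q]
    {A B : Type*} [AddCommGroup A] [Module F A] [AddCommGroup B] [Module F B]
    (α : Representation F G A) (β : Representation F G B) (f : A →ₗ[F] B)
    (hf : ∀ g a, f (α g a) = β g (f a)) (hsurj : Function.Surjective f) (q : Q →ₗ[F] B)
    (hq : ∀ g z, q (MonoidAlgebra.single g (1 : F) • z) = β g (q z)) :
    ∃ l : Q →ₗ[F] A, (∀ g z, l (MonoidAlgebra.single g (1 : F) • z) = α g (l z)) ∧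
      ∀ z, f (l z) = q z := by
  obtain ⟨q', hq'⟩ := β.exists_linearMap_asModule q hq
  obtain ⟨f', hf'⟩ := β.exists_linearMap_asModule (f ∘ₗ α.asModuleEquiv.toLinearMap)
    (fun g z => by
      simp only [LinearMap.comp_apply, LinearEquiv.coe_coe, α.asModuleEquiv_map_single_smul, hf])
  have hf's : Function.Surjective f' := fun b => by
    obtain ⟨a, ha⟩ := hsurj (β.asModuleEquiv b)
    refine ⟨α.asModuleEquiv.symm a, β.asModuleEquiv.injective ?_⟩
    rw [hf', ← ha]
    simp
  obtain ⟨l, hl⟩ := Module.projective_lifting_property f' q' hf's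
  refine ⟨α.asModuleEquiv.toLinearMap ∘ₗ l.restrictScalars F, fun g z => ?_, fun z => ?_⟩
  · simp only [LinearMap.comp_apply, LinearEquiv.coe_coe, LinearMap.restrictScalars_apply, map_smul,
      α.asModuleEquiv_map_single_smul]
  · have := hf' (l z)
    rw [← LinearMap.comp_apply, hl, hq'] at this
    simpa using this.symm

/-- The left regular representation on functions with values in `E`. -/
def Representation.funLeftRegular (F G E : Type*) [Field F] [Group G] [AddCommGroup E]
    [Module F E] : Representation F G (G → E) where
  toFun g := LinearMap.funLeft F E fun x => g⁻¹ * x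
  map_one' := by ext; simp [LinearMap.funLeft]
  map_mul' g h := by ext; simp [LinearMap.funLeft, mul_assoc]

@[simp]
theorem Representation.funLeftRegular_apply {E : Type*} [AddCommGroup E] [Module F E] (g : G)
    (f : G → E) (x : G) : Representation.funLeftRegular F G E g f x = f (g⁻¹ * x) := rfl

/-- The projection of a `φ`-PIM onto its head. -/
theorem IsPIM.exists_head_map {p : ℕ} {L : BrauerLift F} {φ : IBr p L G} {Q : Type*}
    [AddCommGroup Q] [Module F Q] [Module F[G] Q] [IsScalarTower F F[G] Q] (hQ : IsPIM φ Q) :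
    ∃ q : Q →ₗ[F] (Fin φ.degree → F),
    Function.Surjective q ∧ (∀ g z, q (MonoidAlgebra.single g (1 : F) • z) = φ.rep g (q z)) ∧
    ∀ z, q z = 0 ↔ z ∈ Module.jacobson F[G] Q := by
  obtain ⟨e⟩ := hQ.head
  refine ⟨φ.rep.asModuleEquiv.toLinearMap ∘ₗ
    (e.toLinearMap ∘ₗ (Module.jacobson F[G] Q).mkQ).restrictScalars F, ?_, fun g z => ?_,
    fun z => ?_⟩
  · exact φ.rep.asModuleEquiv.surjective.comp
      (e.surjective.comp (Module.jacobson F[G] Q).mkQ_surjective)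
  · simp only [LinearMap.comp_apply, LinearMap.restrictScalars_apply, map_smul]
    exact φ.rep.asModuleEquiv_map_single_smul g _
  · simp [Submodule.Quotient.mk_eq_zero]

variable [Finite G]

/-- If a projective module has a quotient on which the `p`-subgroup `P` has a trivial quotient `E`,
then its dimension is at least `|P| * dim E`. -/
theorem Module.Projective.card_mul_finrank_le {p : ℕ} [Fact p.Prime] [CharP F p] {Q : Type*}
    [AddCommGroup Q] [Module F Q] [Module F[G] Q] [IsScalarTower F F[G] Q]
    [Module.Projective F[G] Q] [Module.Finite F Q] {P : Subgroup G} (hP : IsPGroup p P) {E : Type*}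
    [AddCommGroup E] [Module F E] [Module.Finite F E] (μ : Q →ₗ[F] E) (hμ : Function.Surjective μ)
    (hμP : ∀ g ∈ P, ∀ z, μ (MonoidAlgebra.single g (1 : F) • z) = μ z) :
    Nat.card P * Module.finrank F E ≤ Module.finrank F Q := by
  classical
  have := Fintype.ofFinite P
  let β := (Representation.trivial F P E).indRep
  -- Summation over the cosets of `P` maps functions on `G` onto the module induced from the trivial
  -- `P`-module `E`.
  let f : (G → E) →ₗ[F] (Representation.trivial F P E).indSpace :=
    { toFun := fun a => ⟨fun x => ∑ h : P, a (x * h), fun x j => by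
        rw [Representation.trivial_apply]
        simpa [mul_assoc] using Equiv.sum_comp (Equiv.mulLeft j) fun h : P => a (x * h)⟩
      map_add' := fun a b => by ext; simp [Finset.sum_add_distrib]
      map_smul' := fun c a => by ext; simp [Finset.smul_sum] }
  have hfs : Function.Surjective f := by
    intro b
    refine ⟨fun x => if x = (x : G ⧸ P).out then b.1 x else 0, ?_⟩
    ext x
    change ∑ h : P, (if x * (h : G) = ((x * h : G) : G ⧸ P).out then b.1 (x * h) else 0) = b.1 x
    have hx : x⁻¹ * (x : G ⧸ P).out ∈ P := QuotientGroup.eq.1 (QuotientGroup.out_eq' _).symm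
    rw [Finset.sum_eq_single (⟨_, hx⟩ : P)]
    · have := b.2 x ⟨_, hx⟩
      simp only [mul_inv_cancel_left, Representation.trivial_apply] at this
      simp [this]
    · intro h _ hne
      rw [if_neg]
      intro hxh
      apply hne
      ext
      rw [eq_inv_mul_iff_mul_eq, hxh]
      simp
    · simp
  -- The map corresponding to `μ` under Frobenius reciprocity; projectivity lifts it through `f`.
  let q : Q →ₗ[F] (Representation.trivial F P E).indSpace :=
    { toFun := fun z => ⟨fun x => μ (MonoidAlgebra.single x⁻¹ (1 : F) • z), fun x j => by
        rw [Representation.trivial_apply]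
        have := hμP _ (P.inv_mem j.2) (MonoidAlgebra.single x⁻¹ (1 : F) • z)
        rw [← mul_smul, MonoidAlgebra.single_mul_single, one_mul] at this
        rwa [← mul_inv_rev] at this⟩
      map_add' := fun a b => by ext; simp
      map_smul' := fun c a => by ext; simp [smul_comm _ c] }
  obtain ⟨l, hl, hfl⟩ := Module.Projective.exists_lift_representation
    (Representation.funLeftRegular F G E) β f
    (fun g a => by ext x; simp [f, β, mul_assoc]) hfs q
    (fun g z => by
      ext x
      simp [q, β, ← mul_smul, MonoidAlgebra.single_mul_single])
  -- Restricted to `P`, the lift of `z` has sum `μ z`, so Nakayama makes `r` onto a space of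
  -- dimension `|P| dim E`.
  let r : Q →ₗ[F] (P → E) := LinearMap.funLeft F E (fun h : P => (h : G)) ∘ₗ l
  have hr (z : Q) (h : P) : r z h = l z h := rfl
  have htop : LinearMap.range r = ⊤ := by
    refine hP.eq_top_of_sum_surjective ?_ ?_
    · rintro g _ ⟨z, rfl⟩
      refine ⟨MonoidAlgebra.single (g : G) (1 : F) • z, ?_⟩
      funext h
      rw [hr, hl, hr, Representation.funLeftRegular_apply]
      rfl
    · intro e
      obtain ⟨z, rfl⟩ := hμ e
      refine ⟨r z, ⟨z, rfl⟩, ?_⟩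
      have := congrFun (congrArg Subtype.val (hfl z)) 1
      simpa [f, q, hr, ← MonoidAlgebra.one_def] using this
  have := LinearMap.finrank_le_finrank_of_surjective (LinearMap.range_eq_top.1 htop)
  rwa [Module.finrank_pi_fintype, Finset.sum_const, Finset.card_univ, smul_eq_mul,
    ← Nat.card_eq_fintype_card] at this

/-- A submodule of a module with simple head that is not contained in the radical is everything. -/
theorem Module.eq_top_of_not_le_jacobson {R M : Type*} [Ring R] [AddCommGroup M] [Module R M]
    [Module.Finite R M] (hs : IsSimpleModule R (M ⧸ Module.jacobson R M)) {N : Submodule R M}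
    (hN : ¬ N ≤ Module.jacobson R M) : N = ⊤ := by
  by_contra hne
  obtain ⟨C, hC, hNC⟩ := (eq_top_or_exists_le_coatom N).resolve_left hne
  have hJ : IsCoatom (Module.jacobson R M) := isSimpleModule_iff_isCoatom.1 hs
  have hle : Module.jacobson R M ≤ C := sInf_le hC
  have := (hJ.le_iff.1 hle).resolve_left hC.1
  exact hN (this ▸ hNC)

/-- A module generated by an `H`-stable subspace `θ(W)` has dimension at most `|G : H| dim W`. -/
theorem finrank_le_index_mul_of_span_eq_top {Q : Type*}
    [AddCommGroup Q] [Module F Q] [Module F[G] Q] [IsScalarTower F F[G] Q] {H : Subgroup G}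
    {W : Type*} [AddCommGroup W] [Module F W] [Module.Finite F W] (σ : Representation F H W)
    (θ : W →ₗ[F] Q) (hθ : ∀ (h : H) w, MonoidAlgebra.single (h : G) (1 : F) • θ w = θ (σ h w))
    (htop : Submodule.span F[G] (Set.range θ) = ⊤) :
    Module.finrank F Q ≤ H.index * Module.finrank F W := by
  classical
  have := Fintype.ofFinite (G ⧸ H)
  let T : (G ⧸ H → W) →ₗ[F] Q := LinearMap.lsum F (fun _ => W) F fun c =>
    MonoidAlgebra.GroupSMul.linearMap F Q c.out ∘ₗ θ
  have hT (c : G ⧸ H) (w : W) : T (Pi.single c w) = MonoidAlgebra.single c.out (1 : F) • θ w := by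
    simp only [T]
    rw [LinearMap.lsum_piSingle]
    rfl
  have hxθ (x : G) (w : W) : MonoidAlgebra.single x (1 : F) • θ w ∈ LinearMap.range T := by
    have hmem : (x : G ⧸ H).out⁻¹ * x ∈ H := QuotientGroup.eq.1 (QuotientGroup.out_eq' _)
    refine ⟨Pi.single (x : G ⧸ H) (σ ⟨_, hmem⟩ w), ?_⟩
    rw [hT, ← hθ, ← mul_smul, MonoidAlgebra.single_mul_single]
    simp
  let N : Submodule F[G] Q := MonoidAlgebra.submoduleOfSMulMem (LinearMap.range T) (by
    rintro g _ ⟨b, rfl⟩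
    rw [← Finset.univ_sum_single b, map_sum, Finset.smul_sum]
    refine Submodule.sum_mem _ fun c _ => ?_
    rw [hT, MonoidAlgebra.of_apply, ← mul_smul, MonoidAlgebra.single_mul_single, one_mul]
    exact hxθ _ _)
  have hN : N = ⊤ := by
    rw [eq_top_iff, ← htop, Submodule.span_le]
    rintro _ ⟨w, rfl⟩
    have := hxθ 1 w
    rwa [← MonoidAlgebra.one_def, one_smul] at this
  have hsurj : Function.Surjective T := fun z => by
    have : z ∈ N := hN ▸ trivial
    exact this
  have := LinearMap.finrank_le_finrank_of_surjective hsurj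
  rwa [Module.finrank_pi_fintype, Finset.sum_const, Finset.card_univ, smul_eq_mul,
    ← Nat.card_eq_fintype_card] at this

/-- Upper bound for the dimension of a PIM: if the restriction of the irreducible module to a
`p'`-subgroup `H` contains a quotient of `W` then the PIM is a quotient of the module
induced from `W`. -/
theorem IsPIM.finrank_le_index_mul {p : ℕ} [Fact p.Prime] [CharP F p] {L : BrauerLift F}
    {φ : IBr p L G} {Q : Type*} [AddCommGroup Q] [Module F Q] [Module F[G] Q]
    [IsScalarTower F F[G] Q] [Module.Finite F Q]
    (hQ : IsPIM φ Q) {H : Subgroup G} (hH : (Nat.card H).Coprime p) {W : Type*} [AddCommGroup W]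
    [Module F W] [Module.Finite F W] (σ : Representation F H W) (β : W →ₗ[F] (Fin φ.degree → F))
    (hβ : ∀ (h : H) w, β (σ h w) = φ.rep h (β w)) (hβ0 : β ≠ 0) :
    Module.finrank F Q ≤ H.index * Module.finrank F W := by
  have := Fintype.ofFinite H
  obtain ⟨q, hq, hqG, hqJ⟩ := hQ.exists_head_map
  obtain ⟨r, hr⟩ := q.exists_rightInverse_of_surjective (LinearMap.range_eq_top.2 hq)
  -- A linear section of the head map, summed over `H` to become equivariant. Without dividing, it
  -- lifts `|H| • β`, and `|H|` is nonzero in `F`.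
  let θ : W →ₗ[F] Q := ∑ h : H, MonoidAlgebra.GroupSMul.linearMap F Q (h : G) ∘ₗ r ∘ₗ β ∘ₗ σ h⁻¹
  have hθ (w : W) : θ w = ∑ h : H, MonoidAlgebra.single (h : G) (1 : F) • r (β (σ h⁻¹ w)) := by
    simp [θ, LinearMap.sum_apply]
  have hqθ (w : W) : q (θ w) = (Nat.card H : F) • β w := by
    rw [hθ, map_sum]
    have (h : H) : q (MonoidAlgebra.single (h : G) (1 : F) • r (β (σ h⁻¹ w))) = β w := by
      rw [hqG, ← LinearMap.comp_apply q r, hr, LinearMap.id_apply, ← hβ, ← Module.End.mul_apply,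
        ← map_mul, mul_inv_cancel, map_one, Module.End.one_apply]
    rw [Finset.sum_congr rfl fun h _ => this h, Finset.sum_const, Finset.card_univ,
      Nat.card_eq_fintype_card, Nat.cast_smul_eq_nsmul]
  refine finrank_le_index_mul_of_span_eq_top σ θ (fun h w => ?_) ?_
  · rw [hθ, hθ, Finset.smul_sum, ← Equiv.sum_comp (Equiv.mulLeft h⁻¹)]
    refine Finset.sum_congr rfl fun k _ => ?_
    rw [← mul_smul, MonoidAlgebra.single_mul_single, ← Module.End.mul_apply, ← map_mul]
    simp
  · have : Module.Finite F[G] Q := Module.Finite.of_restrictScalars_finite F F[G] Q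
    obtain ⟨e⟩ := hQ.head
    have := φ.rep_irreducible
    refine Module.eq_top_of_not_le_jacobson (IsSimpleModule.congr e) fun hle => hβ0 ?_
    refine LinearMap.ext fun w => ?_
    have h1 := (hqJ (θ w)).2 (hle (Submodule.subset_span ⟨w, rfl⟩))
    rw [hqθ] at h1
    refine (smul_eq_zero.1 h1).resolve_left ?_
    rw [CharP.cast_eq_zero_iff F p]
    exact (Nat.Prime.coprime_iff_not_dvd Fact.out).1 hH.symm

end ProjectiveBounds

/-! ### Fixed points and coinvariants of induced modules. -/

section FixedPointsInduced

variable {F G W : Type*} [Field F] [Group G] {J : Subgroup G} [AddCommGroup W] [Module F W]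
  (ρ : Representation F J W) (P : Subgroup G)

/-- If every `P^x ∩ J` acts trivially then an induced representation restricted to `P` is a
permutation representation on `G / J`. -/
theorem Representation.exists_section_indSpace_apply_mul
    (hker : ∀ x, (conjSubgroup P x).subgroupOf J ≤ MonoidHom.ker ρ) :
    ∃ s : G ⧸ J → G, (∀ c, (s c : G ⧸ J) = c) ∧
      ∀ (f : ρ.indSpace) (g : P) (c : G ⧸ J), f.1 (g * s c) = f.1 (s (g • c)) := by
  obtain ⟨s, hs, hsk⟩ := exists_section_mul_eq P (MonoidHom.ker ρ) hker
  refine ⟨s, hs, fun f g c => ?_⟩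
  obtain ⟨k, hk, hgk⟩ := hsk g g.2 c
  rw [hgk, ρ.indSpace_apply_mul, (MonoidHom.ker ρ).inv_mem hk]
  rfl

/-- The inducing representation sits in the induced one as the functions supported on `J`. -/
theorem Representation.exists_injective_indSpace :
    ∃ δ : W →ₗ[F] ρ.indSpace, Function.Injective δ ∧ ∀ (j : J) w, ρ.indRep j (δ w) = δ (ρ j w) := by
  classical
  refine ⟨{ toFun := fun w => ⟨fun x => if h : x ∈ J then ρ (⟨x, h⟩ : J)⁻¹ w else 0, fun x j => ?_⟩
            map_add' := fun w w' => ?_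
            map_smul' := fun a w => ?_ }, fun w w' h => ?_, fun j w => ?_⟩
  · by_cases hx : x ∈ J
    · have hxj : x * j ∈ J := J.mul_mem hx j.2
      have : (⟨x * j, hxj⟩ : J)⁻¹ = j⁻¹ * (⟨x, hx⟩ : J)⁻¹ := by rw [← mul_inv_rev]; rfl
      simp only [dif_pos hx, dif_pos hxj, this, map_mul, Module.End.mul_apply]
    · have hxj : x * j ∉ J := fun h => hx ((J.mul_mem_cancel_right j.2).1 h)
      simp only [dif_neg hx, dif_neg hxj, map_zero]
  · ext x
    by_cases hx : x ∈ J <;> simp [hx]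
  · ext x
    by_cases hx : x ∈ J <;> simp [hx]
  · have h1 : (if h : (1 : G) ∈ J then ρ (⟨1, h⟩ : J)⁻¹ w else 0) =
        (if h : (1 : G) ∈ J then ρ (⟨1, h⟩ : J)⁻¹ w' else 0) := congrFun (congrArg Subtype.val h) 1
    rw [dif_pos J.one_mem, dif_pos J.one_mem] at h1
    exact (ρ.apply_bijective _).injective h1
  · ext x
    change (if h : (j : G)⁻¹ * x ∈ J then ρ (⟨(j : G)⁻¹ * x, h⟩ : J)⁻¹ w else 0) =
      if h : x ∈ J then ρ (⟨x, h⟩ : J)⁻¹ (ρ j w) else 0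
    by_cases hx : x ∈ J
    · have hxj : (j : G)⁻¹ * x ∈ J := J.mul_mem (J.inv_mem j.2) hx
      have : (⟨(j : G)⁻¹ * x, hxj⟩ : J)⁻¹ = (⟨x, hx⟩ : J)⁻¹ * j := by ext; simp
      rw [dif_pos hx, dif_pos hxj, this, map_mul, Module.End.mul_apply]
    · have hxj : (j : G)⁻¹ * x ∉ J := fun h => hx ((J.mul_mem_cancel_left (J.inv_mem j.2)).1 h)
      rw [dif_neg hx, dif_neg hxj]

variable [Finite G]

/-- Under the same hypothesis, the `P`-coinvariants contain a copy of `W` for each orbit. -/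
theorem Representation.exists_invariant_surjection_indSpace
    (hker : ∀ x, (conjSubgroup P x).subgroupOf J ≤ MonoidHom.ker ρ) :
    ∃ μ : ρ.indSpace →ₗ[F] (MulAction.orbitRel.Quotient P (G ⧸ J) → W), Function.Surjective μ ∧
      ∀ g ∈ P, ∀ f, μ (ρ.indRep g f) = μ f := by
  classical
  have := Fintype.ofFinite (G ⧸ J)
  obtain ⟨s, hs, hsP⟩ := ρ.exists_section_indSpace_apply_mul P hker
  let e := ρ.indSpaceEquiv s hs
  let π : G ⧸ J → MulAction.orbitRel.Quotient P (G ⧸ J) := Quotient.mk''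
  have hπ (g : P) (c : G ⧸ J) : π (g • c) = π c := Quotient.sound' ⟨g, rfl⟩
  -- Sum the values of `f` over each `P`-orbit of cosets.
  let μ : ρ.indSpace →ₗ[F] (MulAction.orbitRel.Quotient P (G ⧸ J) → W) :=
    { toFun := fun f o => ∑ c, if π c = o then f.1 (s c) else 0
      map_add' := fun f f' => by
        funext o
        simp only [Pi.add_apply, ← Finset.sum_add_distrib]
        refine Finset.sum_congr rfl fun c _ => ?_
        split_ifs <;> simp
      map_smul' := fun a f => by
        funext o
        simp only [Pi.smul_apply, RingHom.id_apply, Finset.smul_sum]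
        refine Finset.sum_congr rfl fun c _ => ?_
        split_ifs <;> simp }
  refine ⟨μ, fun b => ?_, fun g hg f => ?_⟩
  · obtain ⟨f, hf⟩ := e.surjective fun c => if c = (π c).out then b (π c) else 0
    refine ⟨f, ?_⟩
    funext o
    have h1 (c : G ⧸ J) : f.1 (s c) = if c = (π c).out then b (π c) else 0 := congrFun hf c
    have h2 : π o.out = o := Quotient.out_eq' o
    change ∑ c, (if π c = o then _ else 0) = b o
    rw [Finset.sum_eq_single o.out]
    · rw [if_pos h2, h1, h2, if_pos rfl]
    · intro c _ hc
      split_ifs with hco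
      · rw [h1, hco, if_neg hc]
      · rfl
    · simp
  · funext o
    change (∑ c, if π c = o then (ρ.indRep g f).1 (s c) else 0) = ∑ c, if π c = o then f.1 (s c) else 0
    rw [← Equiv.sum_comp (MulAction.toPerm (⟨g, hg⟩⁻¹ : P)) fun c => if π c = o then f.1 (s c) else 0]
    refine Finset.sum_congr rfl fun c _ => ?_
    rw [MulAction.toPerm_apply, hπ, ← hsP]
    rfl

variable [Module.Finite F W]

/-- Mackey's formula for the fixed points of an induced representation, as an upper bound. -/
theorem Representation.finrank_invariants_indRep_le
    [Fintype (MulAction.orbitRel.Quotient P (G ⧸ J))] :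
    Module.finrank F (invariants (ρ.indRep.comp P.subtype)) ≤
      ∑ o : MulAction.orbitRel.Quotient P (G ⧸ J), Module.finrank F
        (invariants (ρ.comp ((conjSubgroup P o.out.out).subgroupOf J).subtype)) := by
  have hf (f : invariants (ρ.indRep.comp P.subtype)) (g : G) (hg : g ∈ P) (x : G) :
      f.1.1 (g * x) = f.1.1 x := by
    have := congrFun (congrArg Subtype.val (f.2 ⟨g⁻¹, P.inv_mem hg⟩)) x
    simpa using this
  -- Evaluate at one representative `x` of each double coset `P x J`; left `P`-invariance forces the
  -- value to be fixed by `P^x ∩ J`.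
  let T : invariants (ρ.indRep.comp P.subtype) →ₗ[F]
      ∀ o : MulAction.orbitRel.Quotient P (G ⧸ J),
        invariants (ρ.comp ((conjSubgroup P o.out.out).subgroupOf J).subtype) :=
    { toFun := fun f o => ⟨f.1.1 o.out.out, fun j => by
        have hj := mem_conjSubgroup.1 (Subgroup.mem_subgroupOf.1 j.2)
        have h1 := hf f _ (P.inv_mem hj) o.out.out
        have h2 := ρ.indSpace_apply_mul f.1 o.out.out j.1⁻¹
        rw [inv_inv] at h2
        change ρ j.1 (f.1.1 o.out.out) = _
        rw [← h2]
        simpa [mul_assoc] using h1⟩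
      map_add' := fun _ _ => rfl
      map_smul' := fun _ _ => rfl }
  rw [← Module.finrank_pi_fintype]
  refine LinearMap.finrank_le_finrank_of_injective (f := T) ?_
  intro f f' hff'
  ext x
  let o : MulAction.orbitRel.Quotient P (G ⧸ J) := Quotient.mk'' (x : G ⧸ J)
  have h0 : f.1.1 o.out.out = f'.1.1 o.out.out := congrArg Subtype.val (congrFun hff' o)
  have hx : o.out ∈ MulAction.orbit P (x : G ⧸ J) :=
    MulAction.orbitRel_apply.1 (Quotient.mk_out (s := MulAction.orbitRel P (G ⧸ J)) (x : G ⧸ J))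
  obtain ⟨g, hg⟩ := MulAction.mem_orbit_symm.1 hx
  have hmem : ((g : G) * o.out.out)⁻¹ * x ∈ J := by
    rw [← QuotientGroup.eq]
    refine Eq.trans ?_ hg
    conv_rhs => rw [← QuotientGroup.out_eq' o.out]
    rfl
  have h1 (f : invariants (ρ.indRep.comp P.subtype)) :
      f.1.1 x = ρ (⟨_, hmem⟩ : J)⁻¹ (f.1.1 o.out.out) := by
    have := ρ.indSpace_apply_mul f.1 (g * o.out.out) ⟨_, hmem⟩
    rwa [hf f g g.2, mul_inv_cancel_left] at this
  rw [h1, h1, h0]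

/-- Under the same hypothesis, the fixed points contain a copy of `W` for each orbit. -/
theorem Representation.card_orbits_mul_finrank_le_finrank_invariants_indRep
    (hker : ∀ x, (conjSubgroup P x).subgroupOf J ≤ MonoidHom.ker ρ) :
    Nat.card (MulAction.orbitRel.Quotient P (G ⧸ J)) * Module.finrank F W ≤
      Module.finrank F (invariants (ρ.indRep.comp P.subtype)) := by
  have := Fintype.ofFinite (MulAction.orbitRel.Quotient P (G ⧸ J))
  obtain ⟨s, hs, hsP⟩ := ρ.exists_section_indSpace_apply_mul P hker
  let e := ρ.indSpaceEquiv s hs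
  let π : G ⧸ J → MulAction.orbitRel.Quotient P (G ⧸ J) := Quotient.mk''
  have hπ (g : P) (c : G ⧸ J) : π (g • c) = π c := Quotient.sound' ⟨g, rfl⟩
  -- In the adapted transversal, functions constant on `P`-orbits are fixed points.
  let T : (MulAction.orbitRel.Quotient P (G ⧸ J) → W) →ₗ[F]
      invariants (ρ.indRep.comp P.subtype) :=
    (e.symm.toLinearMap ∘ₗ LinearMap.funLeft F W π).codRestrict _ fun b g => by
      apply e.injective
      funext c
      change (ρ.indRep g (e.symm (b ∘ π))).1 (s c) = e (e.symm (b ∘ π)) c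
      rw [ρ.indRep_apply_coe, ← Subgroup.coe_inv, hsP]
      change e (e.symm (b ∘ π)) (g⁻¹ • c) = _
      simp only [LinearEquiv.apply_symm_apply, Function.comp_apply, hπ]
  have hT : Function.Injective T := by
    intro b b' h
    have h1 : e.symm (b ∘ π) = e.symm (b' ∘ π) := congrArg Subtype.val h
    exact (Quotient.mk''_surjective).injective_comp_right (e.symm.injective h1)
  have := LinearMap.finrank_le_finrank_of_injective hT
  rwa [Module.finrank_pi_fintype, Finset.sum_const, Finset.card_univ, smul_eq_mul,
    ← Nat.card_eq_fintype_card] at this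

end FixedPointsInduced

/-! ### Fixed points and the PIM of `φ` for a Huppert pair. -/

section HuppertPair

theorem IBr.degree_pos {p : ℕ} {F : Type*} [Field F] {L : BrauerLift F} {G : Type*} [Group G]
    (φ : IBr p L G) : 0 < φ.degree := by
  have := φ.rep_irreducible
  have h := IsSimpleModule.nontrivial F[G] φ.rep.asModule
  by_contra h0
  have h1 : Subsingleton (Fin φ.degree → F) := by
    rw [Nat.eq_zero_of_not_pos h0]
    infer_instance
  exact not_subsingleton φ.rep.asModule h1

theorem IsHuppertPair.ordCompl_degree {p : ℕ} {F : Type*} [Field F] {L : BrauerLift F}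
    {G : Type*} [Group G] [Finite G] {φ : IBr p L G} {J : Subgroup G} {γ : IBr p L J}
    (h : IsHuppertPair φ J γ) :
    ordCompl[p] φ.degree = ordCompl[p] J.index * γ.degree := by
  rw [h.degree_eq, Nat.ordCompl_mul, Nat.factorization_eq_zero_of_not_dvd h.not_dvd_degree, pow_zero,
    Nat.div_one]

variable {p : ℕ} [Fact p.Prime] {F : Type*} [Field F] [IsAlgClosed F] [CharP F p]
  {L : BrauerLift F} {G : Type*} [Group G] [Finite G] {φ : IBr p L G} {J : Subgroup G}
  {γ : IBr p L J}

theorem IsHuppertPair.fixDegree_eq (h : IsHuppertPair φ J γ) (P : Subgroup G) :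
    φ.fixDegree P =
      Module.finrank F (Representation.invariants (γ.rep.indRep.comp P.subtype)) := by
  obtain ⟨e, he⟩ := h.exists_equiv
  have hmap : (Representation.invariants (γ.rep.indRep.comp P.subtype)).map e.toLinearMap =
      Representation.invariants (φ.rep.comp P.subtype) := by
    ext v
    constructor
    · rintro ⟨f, hf, rfl⟩ g
      exact (he g f).symm.trans (congrArg e (hf g))
    · intro hv
      refine ⟨e.symm v, fun g => e.injective ?_, e.apply_symm_apply v⟩
      refine (he g _).trans ?_
      rw [e.apply_symm_apply]
      exact hv g
  unfold IBr.fixDegree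
  rw [← hmap]
  exact LinearEquiv.finrank_map_eq e _

/-- If the number of fixed points is the maximal possible `φ(1)_{p'}` then `J` intersects all Sylow
`p`-subgroups in Sylow subgroups contained in the kernel of `γ`. -/
theorem IsHuppertPair.sylow_of_fixDegree_eq (h : IsHuppertPair φ J γ) (P : Sylow p G)
    (hfix : φ.fixDegree P = ordCompl[p] φ.degree) : ¬ p ∣ γ.ker.index ∧
      ∀ x : G, ∃ S : Sylow p J,
        (S : Subgroup J) = (conjSubgroup (P : Subgroup G) x).subgroupOf J := by
  have := Fintype.ofFinite (MulAction.orbitRel.Quotient P (G ⧸ J))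
  have hle := γ.rep.finrank_invariants_indRep_le (P : Subgroup G)
  rw [← h.fixDegree_eq, hfix, h.ordCompl_degree] at hle
  have hterm (o : MulAction.orbitRel.Quotient P (G ⧸ J)) : Module.finrank F
      (Representation.invariants (γ.rep.comp ((conjSubgroup (P : Subgroup G) o.out.out).subgroupOf
        J).subtype)) ≤ γ.degree := by
    refine (Submodule.finrank_le _).trans_eq ?_
    simp
  have hsum : ∑ o : MulAction.orbitRel.Quotient P (G ⧸ J), γ.degree =
      Nat.card (MulAction.orbitRel.Quotient P (G ⧸ J)) * γ.degree := by
    rw [Finset.sum_const, Finset.card_univ, smul_eq_mul, Nat.card_eq_fintype_card]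
  have hle2 := Finset.sum_le_sum fun (o : MulAction.orbitRel.Quotient P (G ⧸ J))
    (_ : o ∈ Finset.univ) => hterm o
  have hcard := card_orbitRel_quotient_le P J
  -- Both estimates, on the number of orbits and on each Mackey term, must be equalities.
  have hcard_eq : Nat.card (MulAction.orbitRel.Quotient P (G ⧸ J)) = ordCompl[p] J.index := by
    refine le_antisymm hcard (Nat.le_of_mul_le_mul_right ?_ γ.degree_pos)
    rw [← hsum]
    exact hle.trans hle2
  have hsyl := (card_orbitRel_quotient_eq_iff P J).1 hcard_eq
  refine ⟨?_, hsyl⟩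
  have heq := (Finset.sum_eq_sum_iff_of_le fun o _ => hterm o).1
    (le_antisymm hle2 (by rw [hsum, hcard_eq]; exact hle))
  -- One orbit suffices: its Sylow subgroup of `J` fixes all of `W`, hence lies in `Ker γ`.
  let o : MulAction.orbitRel.Quotient P (G ⧸ J) := Quotient.mk'' ((1 : G) : G ⧸ J)
  have htop := Submodule.eq_top_of_finrank_eq
    ((heq o (Finset.mem_univ o)).trans (Module.finrank_fin_fun F).symm)
  obtain ⟨S, hS⟩ := hsyl o.out.out
  have hSker : (S : Subgroup J) ≤ γ.ker := by
    rw [hS]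
    intro j hj
    refine MonoidHom.mem_ker.2 (LinearMap.ext fun w => ?_)
    have hw : w ∈ Representation.invariants
        (γ.rep.comp ((conjSubgroup (P : Subgroup G) o.out.out).subgroupOf J).subtype) :=
      htop ▸ Submodule.mem_top
    exact hw ⟨j, hj⟩
  exact fun hdvd => S.not_dvd_index (hdvd.trans (Subgroup.index_dvd_of_le hSker))

/-- Under the hypothesis on the intersections, the number of fixed points is `φ(1)_{p'}`. -/
theorem IsHuppertPair.fixDegree_eq_of_sylow (h : IsHuppertPair φ J γ) (P : Sylow p G)
    (hker : ¬ p ∣ γ.ker.index) (hsyl : ∀ x : G, ∃ S : Sylow p J,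
      (S : Subgroup J) = (conjSubgroup (P : Subgroup G) x).subgroupOf J) :
    φ.fixDegree P = ordCompl[p] φ.degree := by
  have := Fintype.ofFinite (MulAction.orbitRel.Quotient P (G ⧸ J))
  have hcard := (card_orbitRel_quotient_eq_iff P J).2 hsyl
  rw [h.fixDegree_eq, h.ordCompl_degree]
  refine le_antisymm ((γ.rep.finrank_invariants_indRep_le _).trans ?_) ?_
  · rw [← hcard, Nat.card_eq_fintype_card, ← Finset.card_univ, ← smul_eq_mul, ← Finset.sum_const]
    refine Finset.sum_le_sum fun o _ => (Submodule.finrank_le _).trans_eq ?_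
    simp
  · have hn : γ.ker.Normal := MonoidHom.normal_ker _
    have := γ.rep.card_orbits_mul_finrank_le_finrank_invariants_indRep (P : Subgroup G) fun x =>
      (isPGroup_conjSubgroup_subgroupOf P.isPGroup' J x).le_of_not_dvd_index hker
    rw [Module.finrank_fin_fun] at this
    rwa [← hcard]

/-- Under the hypothesis on the intersections, `Φ_φ(1) = |G|_p φ(1)_{p'}`. -/
theorem IsHuppertPair.finrank_pim_eq_of_sylow (hG : IsPSolvable p G) (h : IsHuppertPair φ J γ)
    (P : Sylow p G) (hker : ¬ p ∣ γ.ker.index) (hsyl : ∀ x : G, ∃ S : Sylow p J,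
      (S : Subgroup J) = (conjSubgroup (P : Subgroup G) x).subgroupOf J) :
    Module.finrank F φ.pim = ordProj[p] (Nat.card G) * ordCompl[p] φ.degree := by
  have hp : p.Prime := Fact.out
  have hfin : Module.Finite F φ.pim :=
    inferInstanceAs (Module.Finite F (φ.pim.restrictScalars F))
  obtain ⟨e, he⟩ := h.exists_equiv
  rw [h.ordCompl_degree]
  refine le_antisymm ?_ ?_
  · obtain ⟨H, hH, k, hk⟩ := (hG.subgroup J).exists_coprime_card_index_eq_pow
    have hidx : H.index = ordProj[p] (Nat.card J) := by
      have hnd : ¬ p ∣ Nat.card H := (Nat.Prime.coprime_iff_not_dvd hp).1 hH.symm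
      rw [← H.card_mul_index, hk, Nat.factorization_mul Nat.card_pos.ne' (pow_ne_zero _ hp.ne_zero),
        Finsupp.add_apply, Nat.factorization_eq_zero_of_not_dvd hnd, hp.factorization_pow]
      simp
    obtain ⟨δ, hδ, hδJ⟩ := γ.rep.exists_injective_indSpace
    have hle : H.map J.subtype ≤ J := Subgroup.map_subtype_le H
    have hcard : (Nat.card (H.map J.subtype)).Coprime p := by
      rwa [Subgroup.card_map_of_injective J.subtype_injective]
    -- The `H`-map is the restriction of the embedding of `W` into `Ind_J^G W ≅ V`.
    have := φ.isPIM_pim.finrank_le_index_mul hcard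
      (γ.rep.comp (Subgroup.inclusion hle)) (e.toLinearMap ∘ₗ δ) (fun h w => by
        simp only [LinearMap.comp_apply, LinearEquiv.coe_coe, ← he]
        exact congrArg e (hδJ (Subgroup.inclusion hle h) w).symm) (fun h0 => by
        have : Nonempty (Fin γ.degree) := ⟨⟨0, γ.degree_pos⟩⟩
        obtain ⟨w, hw⟩ := exists_ne (0 : Fin γ.degree → F)
        exact hw (hδ (e.injective ((LinearMap.congr_fun h0 w).trans (by simp)))))
    rw [Subgroup.index_map_subtype, hidx, Module.finrank_fin_fun] at this
    refine this.trans_eq ?_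
    rw [← ordProj_index_mul_ordProj_card p J]
    conv_lhs => rw [← Nat.ordProj_mul_ordCompl_eq_self J.index p]
    ring
  · have hn : γ.ker.Normal := MonoidHom.normal_ker _
    obtain ⟨μ, hμ, hμP⟩ := γ.rep.exists_invariant_surjection_indSpace (P : Subgroup G) fun x =>
      (isPGroup_conjSubgroup_subgroupOf P.isPGroup' J x).le_of_not_dvd_index hker
    obtain ⟨q, hq, hqG, -⟩ := φ.isPIM_pim.exists_head_map
    have hproj := φ.isPIM_pim.projective
    have := Fintype.ofFinite (MulAction.orbitRel.Quotient P (G ⧸ J))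
    have key := Module.Projective.card_mul_finrank_le P.isPGroup' (μ ∘ₗ e.symm.toLinearMap ∘ₗ q)
      (hμ.comp (e.symm.surjective.comp hq)) fun g hg z => by
        simp only [LinearMap.comp_apply, LinearEquiv.coe_coe, hqG]
        rw [← hμP g hg (e.symm (q z))]
        congr 1
        rw [e.symm_apply_eq, he, e.apply_symm_apply]
    rw [P.card_eq_multiplicity, Module.finrank_pi_fintype, Finset.sum_const, Finset.card_univ,
      smul_eq_mul, ← Nat.card_eq_fintype_card, (card_orbitRel_quotient_eq_iff P J).2 hsyl,
      Module.finrank_fin_fun] at key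
    exact key

end HuppertPair

theorem mainTheorem5 {p : ℕ} [Fact p.Prime] {F : Type*} [Field F] [IsAlgClosed F] [CharP F p]
    (L : BrauerLift F) {G : Type*} [Group G] [Finite G] (hG : IsPSolvable p G)
    (P : Sylow p G) (φ : IBr p L G) (J : Subgroup G) (γ : IBr p L J)
    (hJ : IsHuppertPair φ J γ) :
    ((φ.fixDegree (P : Subgroup G) : ℚ) = φ.c ∧ φ.c = (ordCompl[p] φ.degree : ℕ)) ↔
      (¬ p ∣ γ.ker.index ∧
        ∀ x : G, ∃ S : Sylow p J,
          (S : Subgroup J) = (conjSubgroup (P : Subgroup G) x).subgroupOf J) := by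
  constructor
  · rintro ⟨h1, h2⟩
    -- Of a), only the resulting equality of `φ^{Fix(P)}(1)` and `φ(1)_{p'}` is needed.
    exact hJ.sylow_of_fixDegree_eq P (by exact_mod_cast h1.trans h2)
  · rintro ⟨hker, hsyl⟩
    have hc : φ.c = (ordCompl[p] φ.degree : ℕ) := by
      have h0 : ((ordProj[p] (Nat.card G) : ℕ) : ℚ) ≠ 0 :=
        Nat.cast_ne_zero.2 (Nat.ordProj_pos _ _).ne'
      rw [IBr.c, hJ.finrank_pim_eq_of_sylow hG P hker hsyl, Nat.cast_mul, mul_div_cancel_left₀ _ h0]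
    exact ⟨by rw [hc, hJ.fixDegree_eq_of_sylow P hker hsyl], hc⟩
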